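/- Let $K$ be a field of characteristic $0$, and for $k\ge 0$ let $V_k$ denote the $SL_2(K)$-module of binary forms of degree $k$ over $K$, i.e. homogeneous polynomial functions $f$ of degree $k$ on $K^2$ with $(gf)(v)=f(g^{-1}v)$. Let $KX_d$ be the $K$-vector space with basis $X_d=\{x_1,\ldots,x_d\}$, endowed with a linear action of $SL_2(K)$ such that, as an $SL_2(K)$-module, $$KX_d\cong V_{k_1}\oplus\cdots\oplus V_{k_r},\qquad (k_1,\ldots,k_r)\neq(0,\ldots,0).$$ Let $F_d=L_d/L_d''$ be the free metabelian Lie algebra over $K$ freely generated by $X_d$, where $L_d$ is the free Lie algebra on $X_d$ and $L_d''=[[L_d,L_d],[L_d,L_d]]$. Extend the action of $SL_2(K)$ diagonally to $F_d$ by $g(f(x_1,\ldots,x_d))=f(g(x_1),\ldots,g(x_d))$, and let $$F_d^{SL_2(K)}=\{f\in F_d\mid g(f)=f\ \text{for all } g\in SL_2(K)\}$$ be the Lie algebra of invariants. Then $F_d^{SL_2(K)}$ is finitely generated as a Lie algebra if and only if, as an $SL_2(K)$-module, either $$KX_d\cong V_1\oplus \underbrace{V_0\oplus\cdots\oplus V_0}_{m}\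 \text{ for some } m\ge 0,\qquad\text{or}\qquad KX_d\cong V_2.$$ -/

import Mathlib

open scoped DirectSum MatrixGroups

noncomputable section

namespace MetabelianInvariants

/-! ### Binary forms -/

section BinaryForms

variable (K : Type*) [Field K]

/-- The action of `SL₂(K)` on polynomial functions on `K²`: `(g f)(v) = f (g⁻¹ v)`. On the
coordinate functions it is `X i ↦ ∑ j, (g⁻¹) i j • X j`. -/
def polyAction (g : SL(2, K)) : MvPolynomial (Fin 2) K →ₐ[K] MvPolynomial (Fin 2) K :=
  MvPolynomial.aeval fun i => ∑ j, MvPolynomial.C ((g⁻¹).1 i j) * MvPolynomial.X j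

theorem polyAction_X (g : SL(2, K)) (i : Fin 2) :
    polyAction K g (MvPolynomial.X i) =
      ∑ j, MvPolynomial.C ((g⁻¹).1 i j) * MvPolynomial.X j := by
  simp [polyAction]

theorem polyAction_one : polyAction K 1 = AlgHom.id K _ := by
  apply MvPolynomial.algHom_ext
  intro i
  rw [polyAction_X]
  fin_cases i <;> simp [Fin.sum_univ_two]

theorem polyAction_mul (g h : SL(2, K)) :
    polyAction K (g * h) = (polyAction K g).comp (polyAction K h) := by
  apply MvPolynomial.algHom_ext
  intro i
  have hC : ∀ (c : K), polyAction K g (MvPolynomial.C c) = MvPolynomial.C c :=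
    fun c => (polyAction K g).commutes c
  simp only [AlgHom.comp_apply, polyAction_X, map_mul, hC, mul_inv_rev,
    Matrix.SpecialLinearGroup.coe_mul, Matrix.mul_apply, Fin.sum_univ_two, map_add]
  ring

theorem polyAction_mem (k : ℕ) (g : SL(2, K)) {f : MvPolynomial (Fin 2) K}
    (hf : f ∈ MvPolynomial.homogeneousSubmodule (Fin 2) K k) :
    polyAction K g f ∈ MvPolynomial.homogeneousSubmodule (Fin 2) K k := by
  rw [MvPolynomial.mem_homogeneousSubmodule] at hf ⊢
  have h := hf.aeval (fun i => ∑ j, MvPolynomial.C ((g⁻¹).1 i j) * MvPolynomial.X j)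
    (n := 1) fun i => MvPolynomial.IsHomogeneous.sum _ _ _ fun j _ => by
      simpa using (MvPolynomial.isHomogeneous_C (Fin 2) ((g⁻¹).1 i j)).mul
        (MvPolynomial.isHomogeneous_X K j)
  simpa [polyAction] using h

/-- The `SL₂(K)`-module `V_k` of binary forms of degree `k`. -/
def binaryForms (k : ℕ) :
    Representation K SL(2, K) (MvPolynomial.homogeneousSubmodule (Fin 2) K k) where
  toFun g := (polyAction K g).toLinearMap.restrict fun _ hf => polyAction_mem K k g hf
  map_one' := by
    ext f : 2
    simp [LinearMap.restrict_apply, polyAction_one]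
  map_mul' g h := by
    ext f : 2
    exact DFunLike.congr_fun (polyAction_mul K g h) f.1

/-- The `SL₂(K)`-module `V_{k 0} ⊕ ⋯ ⊕ V_{k (r - 1)}`. -/
def sumOfBinaryForms {r : ℕ} (k : Fin r → ℕ) :
    Representation K SL(2, K)
      (⨁ i : Fin r, MvPolynomial.homogeneousSubmodule (Fin 2) K (k i)) :=
  Representation.directSum fun i => binaryForms K (k i)

end BinaryForms

/-! ### The free metabelian Lie algebra -/

section FreeMetabelian

variable (K : Type*) [Field K] (d : ℕ)

/-- The free metabelian Lie algebra `F_d = L_d / L_d''`, where `L_d` is the free Lie algebra on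
`d` generators. -/
abbrev FreeMetabelian : Type _ :=
  FreeLieAlgebra K (Fin d) ⧸ LieAlgebra.derivedSeries K (FreeLieAlgebra K (Fin d)) 2

/-- The canonical map `L_d → F_d`. -/
def toFreeMetabelian : FreeLieAlgebra K (Fin d) →ₗ⁅K⁆ FreeMetabelian K d :=
  { (LieAlgebra.derivedSeries K (FreeLieAlgebra K (Fin d)) 2).toSubmodule.mkQ with
    map_lie' := fun {_ _} => rfl }

/-- The embedding of `KX_d` (formal linear combinations of `x_1, …, x_d`) in `L_d`. -/
def linearPart : (Fin d →₀ K) →ₗ[K] FreeLieAlgebra K (Fin d) :=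
  Finsupp.linearCombination K (FreeLieAlgebra.of K)

variable {K d}

/-- The endomorphism of `L_d` extending a linear endomorphism `φ` of `KX_d`:
`f(x_1, …, x_d) ↦ f(φ x_1, …, φ x_d)`. -/
def freeLieMap (φ : Module.End K (Fin d →₀ K)) :
    FreeLieAlgebra K (Fin d) →ₗ⁅K⁆ FreeLieAlgebra K (Fin d) :=
  FreeLieAlgebra.lift K fun j => linearPart K d (φ (Finsupp.single j 1))

theorem freeLieMap_mem (φ : Module.End K (Fin d →₀ K)) {f : FreeLieAlgebra K (Fin d)}
    (hf : f ∈ LieAlgebra.derivedSeries K (FreeLieAlgebra K (Fin d)) 2) :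
    freeLieMap φ f ∈ LieAlgebra.derivedSeries K (FreeLieAlgebra K (Fin d)) 2 :=
  LieIdeal.derivedSeries_map_le (f := freeLieMap φ) 2 (LieIdeal.mem_map hf)

/-- The endomorphism of `F_d` extending a linear endomorphism `φ` of `KX_d`:
`f(x_1, …, x_d) ↦ f(φ x_1, …, φ x_d)`. -/
def freeMetabelianMap (φ : Module.End K (Fin d →₀ K)) :
    FreeMetabelian K d →ₗ⁅K⁆ FreeMetabelian K d :=
  { Submodule.mapQ (LieAlgebra.derivedSeries K (FreeLieAlgebra K (Fin d)) 2).toSubmodule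
      (LieAlgebra.derivedSeries K (FreeLieAlgebra K (Fin d)) 2).toSubmodule
      (freeLieMap φ : FreeLieAlgebra K (Fin d) →ₗ[K] FreeLieAlgebra K (Fin d))
      (fun _ hf => freeLieMap_mem φ hf) with
    map_lie' := by
      intro x y
      induction x using Submodule.Quotient.induction_on with | _ x
      induction y using Submodule.Quotient.induction_on with | _ y
      exact congrArg (toFreeMetabelian K d) ((freeLieMap φ).map_lie x y) }

theorem freeMetabelianMap_gen (φ : Module.End K (Fin d →₀ K)) (j : Fin d) :
    freeMetabelianMap φ (toFreeMetabelian K d (FreeLieAlgebra.of K j)) =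
      toFreeMetabelian K d (linearPart K d (φ (Finsupp.single j 1))) :=
  congrArg (toFreeMetabelian K d) (FreeLieAlgebra.lift_of_apply _ j)

/-- The Lie algebra of invariants `F_d^G`, where the group `G` acts linearly on `KX_d` by `ρ` and
this action is extended diagonally to `F_d`. -/
def invariants {G : Type*} [Group G] (ρ : Representation K G (Fin d →₀ K)) :
    LieSubalgebra K (FreeMetabelian K d) where
  carrier := {f | ∀ g : G, freeMetabelianMap (ρ g) f = f}
  add_mem' {a b} ha hb g := by rw [map_add, ha g, hb g]
  zero_mem' g := map_zero _
  smul_mem' c a ha g := by rw [map_smul, ha g]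
  lie_mem' {a b} ha hb g := by rw [LieHom.map_lie, ha g, hb g]

end FreeMetabelian

/-- A Lie subalgebra is finitely generated (as a Lie algebra). -/
def IsFinitelyGenerated {K L : Type*} [Field K] [LieRing L] [LieAlgebra K L]
    (A : LieSubalgebra K L) : Prop :=
  ∃ S : Finset L, LieSubalgebra.lieSpan K L (S : Set L) = A

end MetabelianInvariants

end

/-!
The invariants of `SL₂(K)` in the free metabelian Lie algebra `F_d` are finitely generated only
for `V_1 ⊕ V_0 ⊕ ⋯ ⊕ V_0` and for `V_2`. The idea is to replace elements of `F_d` by functions.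
For functionals `σ`, `τ` on `KX_d` let `phi σ τ` be the homomorphism from `F_d` to the
two-dimensional non-abelian Lie algebra that maps a generator `x` to `(τ x, σ x)`. By the
exactness of a Koszul complex (`commSum_eq_zero`) these homomorphisms separate the points of
`F_d` (`eq_of_phi`), and `phi σ τ f = (τ w, σ w + B (σ, τ))`, where `w` is the linear part of
`f` and `B` is a covector field: linear in `σ`, polynomial in `τ` and zero for `σ = τ`
(`exists_phi_eq`). The element `f` is invariant exactly when this function of `(σ, τ)` is
invariant. Bracketing two elements multiplies their fields by the scalars `τ w` only. As the
linear part of an invariant lies in the trivial summands, the degree of `B` along the nontrivial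
summands cannot grow when brackets of invariants are taken. So the invariants are not finitely
generated as soon as one nonzero invariant of the derived ideal can be multiplied by all powers
of an invariant polynomial of positive degree on the nontrivial summands
(`not_isFinitelyGenerated`).

Such pairs come from the symbolic method: a product of brackets `[i, j]` of points of the plane,
in which the point `v` occurs `k v` times, defines an invariant multilinear form on the duals of
the `V_{k v}` (`exists_contraction`, `contraction_invariant`). The invariant element of the
derived ideal is the commutator given by the symplectic form on a summand of odd degree, or, on
a summand of even degree, the Koszul commutator (`exists_koszul`) of the gradient of the
quadratic invariant and of a covector field not proportional to it. This second field is the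
gradient of the quadratic invariant of another summand of even degree, or of the cubic invariant
of quartics, or a field of degree three for even degree at least six. These cases exhaust all
representations other than the two in the statement.

On `V_2` there is no nonzero invariant. The functional reading off the middle coefficient is
fixed by a torus, so that at its multiples the field can be nonzero only in the diagonal
direction, where it is zero; and the translates of these multiples are dense
(`quadratic_field_eq_zero`). On `V_1 ⊕ V_0 ⊕ ⋯ ⊕ V_0` the group acts transitively on the nonzero
vectors of `V_1`, which forces the field of an invariant to be a field of the trivial summands
plus the determinant times a coefficient that is a polynomial on the trivial summands
(`Frame.fieldEv_eq_of_invariant`). Hence the trivial summands and the commutator of a basis of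
`V_1` generate the invariants (`Frame.isFinitelyGenerated_of_one`).
-/

open scoped DirectSum MatrixGroups

noncomputable section

namespace MetabelianInvariants

/-! ### The two-dimensional Lie algebra and the functionals on the free metabelian Lie algebra -/

/-- The two-dimensional non-abelian Lie algebra, on `K × K` with bracket
`⁅(a, b), (c, e)⁆ = (0, a e - c b)`. -/
def Aff (K : Type*) : Type _ := K × K

namespace Aff

@[ext] theorem ext {K : Type*} {x y : Aff K} (h₁ : x.1 = y.1) (h₂ : x.2 = y.2) : x = y :=
  Prod.ext h₁ h₂

/-- The element `(a, b)` of `Aff K`. -/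
def of {K : Type*} (a b : K) : Aff K := (a, b)

@[simp] theorem of_fst {K : Type*} (a b : K) : (of a b).1 = a := rfl
@[simp] theorem of_snd {K : Type*} (a b : K) : (of a b).2 = b := rfl

variable {K : Type*} [Field K]

instance : AddCommGroup (Aff K) := inferInstanceAs (AddCommGroup (K × K))
instance : Module K (Aff K) := inferInstanceAs (Module K (K × K))

instance : Bracket (Aff K) (Aff K) := ⟨fun x y => (0, x.1 * y.2 - y.1 * x.2)⟩

@[simp] theorem lie_fst (x y : Aff K) : (⁅x, y⁆ : Aff K).1 = 0 := rfl
@[simp] theorem lie_snd (x y : Aff K) : (⁅x, y⁆ : Aff K).2 = x.1 * y.2 - y.1 * x.2 := rfl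
@[simp] theorem add_fst (x y : Aff K) : (x + y).1 = x.1 + y.1 := rfl
@[simp] theorem add_snd (x y : Aff K) : (x + y).2 = x.2 + y.2 := rfl
@[simp] theorem zero_fst : (0 : Aff K).1 = 0 := rfl
@[simp] theorem zero_snd : (0 : Aff K).2 = 0 := rfl
@[simp] theorem smul_fst (c : K) (x : Aff K) : (c • x).1 = c * x.1 := rfl
@[simp] theorem smul_snd (c : K) (x : Aff K) : (c • x).2 = c * x.2 := rfl
@[simp] theorem sub_fst (x y : Aff K) : (x - y).1 = x.1 - y.1 := rfl
@[simp] theorem sub_snd (x y : Aff K) : (x - y).2 = x.2 - y.2 := rfl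

instance : LieRing (Aff K) where
  add_lie x y z := by ext <;> simp; ring
  lie_add x y z := by ext <;> simp; ring
  lie_self x := by ext <;> simp
  leibniz_lie x y z := by ext <;> simp; ring

instance : LieAlgebra K (Aff K) where
  lie_smul c x y := by ext <;> simp; ring

/-- The first coordinate as a linear map. -/
def fstₗ : Aff K →ₗ[K] K := LinearMap.fst K K K

/-- The second coordinate as a linear map. -/
def sndₗ : Aff K →ₗ[K] K := LinearMap.snd K K K

theorem sum_fst {ι : Type*} (s : Finset ι) (f : ι → Aff K) :
    (∑ i ∈ s, f i).1 = ∑ i ∈ s, (f i).1 := map_sum (fstₗ (K := K)) f s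

theorem sum_snd {ι : Type*} (s : Finset ι) (f : ι → Aff K) :
    (∑ i ∈ s, f i).2 = ∑ i ∈ s, (f i).2 := map_sum (sndₗ (K := K)) f s

end Aff

section Functionals

variable {K : Type*} [Field K] {d : ℕ}

/-- The image in `F_d` of an element of `KX_d`. -/
def lin : (Fin d →₀ K) →ₗ[K] FreeMetabelian K d :=
  (toFreeMetabelian K d : FreeLieAlgebra K (Fin d) →ₗ[K] FreeMetabelian K d) ∘ₗ linearPart K d

/-- The free generators of `F_d`. -/
def gen (j : Fin d) : FreeMetabelian K d := lin (Finsupp.single j 1)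

theorem toFreeMetabelian_of (j : Fin d) :
    toFreeMetabelian K d (FreeLieAlgebra.of K j) = gen j := by
  simp [gen, lin, linearPart]

theorem lin_eq_sum (w : Fin d →₀ K) : lin w = ∑ j, w j • (gen j : FreeMetabelian K d) := by
  conv_lhs => rw [← Finsupp.univ_sum_single w]
  rw [map_sum]
  refine Finset.sum_congr rfl fun j _ => ?_
  rw [gen, ← map_smul, Finsupp.smul_single, smul_eq_mul, mul_one]

theorem toFreeMetabelian_surjective : Function.Surjective (toFreeMetabelian K d) :=
  Submodule.Quotient.mk_surjective _

theorem freeLie_lift_range_le {L : Type*} [LieRing L] [LieAlgebra K L] (A : LieSubalgebra K L)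
    (f : FreeLieAlgebra K (Fin d) →ₗ⁅K⁆ L) (h : ∀ j, f (FreeLieAlgebra.of K j) ∈ A)
    (x : FreeLieAlgebra K (Fin d)) : f x ∈ A := by
  have : f = A.incl.comp (FreeLieAlgebra.lift K fun j => (⟨_, h j⟩ : A)) := by
    ext j
    simp
  rw [this]
  exact Subtype.property _

/-- A Lie subalgebra of `F_d` that contains the free generators is everything. -/
theorem mem_of_gen_mem (A : LieSubalgebra K (FreeMetabelian K d)) (h : ∀ j, gen j ∈ A)
    (f : FreeMetabelian K d) : f ∈ A := by
  obtain ⟨x, rfl⟩ := toFreeMetabelian_surjective f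
  exact freeLie_lift_range_le A _ (fun j => by rw [toFreeMetabelian_of]; exact h j) x

theorem metabelian (a b c e : FreeMetabelian K d) : ⁅⁅a, b⁆, ⁅c, e⁆⁆ = 0 := by
  obtain ⟨a, rfl⟩ := toFreeMetabelian_surjective a
  obtain ⟨b, rfl⟩ := toFreeMetabelian_surjective b
  obtain ⟨c, rfl⟩ := toFreeMetabelian_surjective c
  obtain ⟨e, rfl⟩ := toFreeMetabelian_surjective e
  simp only [← LieHom.map_lie]
  refine (Submodule.Quotient.mk_eq_zero _).2 ?_
  exact LieSubmodule.lie_mem_lie (LieSubmodule.lie_mem_lie trivial trivial)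
    (LieSubmodule.lie_mem_lie trivial trivial)

theorem lie_eq_zero_of_mem_derivedSeries_one {L : Type*} [LieRing L] [LieAlgebra K L]
    (hL : ∀ a b c e : L, ⁅⁅a, b⁆, ⁅c, e⁆⁆ = 0) {x y : L}
    (hx : x ∈ LieAlgebra.derivedSeries K L 1) (hy : y ∈ LieAlgebra.derivedSeries K L 1) :
    ⁅x, y⁆ = 0 := by
  have key : ∀ (z : L), (∀ a b : L, ⁅⁅a, b⁆, z⁆ = 0) →
      ∀ x ∈ LieAlgebra.derivedSeries K L 1, ⁅x, z⁆ = 0 := by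
    intro z hz x hx₀
    have hx' : x ∈ (⁅(⊤ : LieIdeal K L), (⊤ : LieIdeal K L)⁆ : LieIdeal K L) := hx₀
    rw [← LieSubmodule.mem_toSubmodule, LieSubmodule.lieIdeal_oper_eq_linear_span] at hx'
    clear hx₀
    induction hx' using Submodule.span_induction with
    | mem x h => obtain ⟨a, b, rfl⟩ := h; exact hz _ _
    | zero => simp
    | add x y _ _ hx hy => rw [add_lie, hx, hy, add_zero]
    | smul c x _ hx => rw [smul_lie, hx, smul_zero]
  refine key y (fun a b => ?_) x hx
  rw [← lie_skew, key _ (fun c e => hL _ _ _ _) y hy, neg_zero]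

theorem derivedSeries_two_eq_bot {L : Type*} [LieRing L] [LieAlgebra K L]
    (hL : ∀ a b c e : L, ⁅⁅a, b⁆, ⁅c, e⁆⁆ = 0) : LieAlgebra.derivedSeries K L 2 = ⊥ := by
  rw [eq_bot_iff]
  refine (LieSubmodule.lie_le_iff _ _ _).2 fun x hx y hy => ?_
  rw [LieSubmodule.mem_bot]
  exact lie_eq_zero_of_mem_derivedSeries_one hL hx hy

/-- The Lie algebra homomorphism `F_d → Aff K` with `w ↦ (τ w, σ w)` on `KX_d`. -/
def phi (σ τ : Module.Dual K (Fin d →₀ K)) : FreeMetabelian K d →ₗ⁅K⁆ Aff K :=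
  { Submodule.liftQ (LieAlgebra.derivedSeries K (FreeLieAlgebra K (Fin d)) 2).toSubmodule
      ((FreeLieAlgebra.lift K fun j =>
        Aff.of (τ (Finsupp.single j 1)) (σ (Finsupp.single j 1)) :
        FreeLieAlgebra K (Fin d) →ₗ⁅K⁆ Aff K) : FreeLieAlgebra K (Fin d) →ₗ[K] Aff K)
      (fun x hx => by
        have h := LieIdeal.derivedSeries_map_le (f := FreeLieAlgebra.lift K fun j =>
          Aff.of (τ (Finsupp.single j 1)) (σ (Finsupp.single j 1))) 2 (LieIdeal.mem_map hx)
        rw [derivedSeries_two_eq_bot (fun a b c e => by ext <;> simp; ring)] at h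
        exact h) with
    map_lie' := by
      intro x y
      induction x using Submodule.Quotient.induction_on with | _ x
      induction y using Submodule.Quotient.induction_on with | _ y
      exact LieHom.map_lie (FreeLieAlgebra.lift K fun j =>
        Aff.of (τ (Finsupp.single j 1)) (σ (Finsupp.single j 1))) x y }

theorem phi_gen (σ τ : Module.Dual K (Fin d →₀ K)) (j : Fin d) :
    phi σ τ (gen j) = Aff.of (τ (Finsupp.single j 1)) (σ (Finsupp.single j 1)) := by
  rw [← toFreeMetabelian_of]
  exact FreeLieAlgebra.lift_of_apply _ j

theorem phi_lin (σ τ : Module.Dual K (Fin d →₀ K)) (w : Fin d →₀ K) :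
    phi σ τ (lin w) = Aff.of (τ w) (σ w) := by
  have h : ∀ χ : Module.Dual K (Fin d →₀ K), χ w = ∑ j, w j * χ (Finsupp.single j 1) := by
    intro χ
    conv_lhs => rw [← Finsupp.univ_sum_single w]
    rw [map_sum]
    refine Finset.sum_congr rfl fun j _ => ?_
    rw [← smul_eq_mul, ← map_smul, Finsupp.smul_single, smul_eq_mul, mul_one]
  rw [lin_eq_sum, map_sum]
  ext
  · simp [Aff.sum_fst, phi_gen, h τ]
  · simp [Aff.sum_snd, phi_gen, h σ]

theorem freeMetabelianMap_lin (φ : Module.End K (Fin d →₀ K)) (w : Fin d →₀ K) :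
    freeMetabelianMap φ (lin w) = lin (φ w) := by
  conv_rhs => rw [← Finsupp.univ_sum_single w]
  rw [lin_eq_sum, map_sum, map_sum, map_sum]
  refine Finset.sum_congr rfl fun j _ => ?_
  rw [map_smul, ← toFreeMetabelian_of, freeMetabelianMap_gen,
    show Finsupp.single j (w j) = w j • Finsupp.single j (1 : K) by simp, map_smul, map_smul]
  rfl

/-- Equality of Lie algebra homomorphisms out of `F_d` can be tested on generators. -/
theorem hom_eq_of_gen {L : Type*} [LieRing L] [LieAlgebra K L]
    {f g : FreeMetabelian K d →ₗ⁅K⁆ L} (h : ∀ j, f (gen j) = g (gen j))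
    (x : FreeMetabelian K d) : f x = g x := by
  let A : LieSubalgebra K (FreeMetabelian K d) :=
    { carrier := {x | f x = g x}
      add_mem' := fun {a b} ha hb => by
        change f (a + b) = g (a + b)
        rw [map_add, map_add, show f a = g a from ha, show f b = g b from hb]
      zero_mem' := by
        change f 0 = g 0
        rw [map_zero, map_zero]
      smul_mem' := fun c a ha => by
        change f (c • a) = g (c • a)
        rw [map_smul, map_smul, show f a = g a from ha]
      lie_mem' := fun {a b} ha hb => by
        change f ⁅a, b⁆ = g ⁅a, b⁆
        rw [LieHom.map_lie, LieHom.map_lie, show f a = g a from ha, show f b = g b from hb] }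
  exact mem_of_gen_mem A h x

theorem phi_map (φ : Module.End K (Fin d →₀ K)) (σ τ : Module.Dual K (Fin d →₀ K))
    (f : FreeMetabelian K d) :
    phi σ τ (freeMetabelianMap φ f) = phi (σ ∘ₗ φ) (τ ∘ₗ φ) f := by
  refine hom_eq_of_gen (f := (phi σ τ).comp (freeMetabelianMap φ)) (fun j => ?_) f
  rw [phi_gen, LieHom.comp_apply, gen, freeMetabelianMap_lin, phi_lin]
  rfl

end Functionals

/-! ### The structure of the free metabelian Lie algebra -/

section Structure

variable {K : Type*} [Field K] {d : ℕ}

variable (K d) in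
/-- The derived ideal `F_d'` of the free metabelian Lie algebra. -/
abbrev derivedIdeal : LieIdeal K (FreeMetabelian K d) :=
  LieAlgebra.derivedSeries K (FreeMetabelian K d) 1

theorem lie_mem_derivedIdeal (x y : FreeMetabelian K d) : ⁅x, y⁆ ∈ derivedIdeal K d :=
  LieSubmodule.lie_mem_lie trivial trivial

/-- The commutator of two elements as an element of the derived ideal. -/
def comm (x y : FreeMetabelian K d) : derivedIdeal K d := ⟨⁅x, y⁆, lie_mem_derivedIdeal x y⟩

/-- The adjoint action of a generator on the derived ideal. -/
def adGen (j : Fin d) : Module.End K (derivedIdeal K d) :=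
  LieModule.toEnd K (FreeMetabelian K d) (derivedIdeal K d) (gen j)

theorem adGen_apply (j : Fin d) (z : derivedIdeal K d) :
    ((adGen j z : derivedIdeal K d) : FreeMetabelian K d) =
      ⁅(gen j : FreeMetabelian K d), (z : FreeMetabelian K d)⁆ :=
  rfl

theorem lie_derived (x y : derivedIdeal K d) :
    ⁅(x : FreeMetabelian K d), (y : FreeMetabelian K d)⁆ = 0 :=
  lie_eq_zero_of_mem_derivedSeries_one metabelian x.2 y.2

theorem adGen_mul_comm (i j : Fin d) : (adGen i : Module.End K (derivedIdeal K d)) * adGen j =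
    adGen j * adGen i := by
  ext z
  change ⁅gen i, ⁅gen j, (z : FreeMetabelian K d)⁆⁆ = ⁅gen j, ⁅gen i, (z : FreeMetabelian K d)⁆⁆
  rw [leibniz_lie, show ⁅⁅gen i, gen j⁆, (z : FreeMetabelian K d)⁆ = 0 from
    lie_derived (comm (gen i) (gen j)) z, zero_add]

variable (K d) in
/-- The commutative algebra of operators on the derived ideal generated by the adjoint actions of
the generators. -/
abbrev adAlgebra : Subalgebra K (Module.End K (derivedIdeal K d)) :=
  Algebra.adjoin K (Set.range adGen)

instance : IsMulCommutative (adAlgebra K d) :=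
  Algebra.isMulCommutative_adjoin K (by
    rintro _ ⟨i, rfl⟩ _ ⟨j, rfl⟩
    exact adGen_mul_comm i j)

open scoped IsMulCommutative in
/-- The action of polynomials on the derived ideal, in which the variables act as the adjoint
actions of the generators. -/
def polyAct : MvPolynomial (Fin d) K →ₐ[K] Module.End K (derivedIdeal K d) :=
  (adAlgebra K d).val.comp (MvPolynomial.aeval fun j =>
    (⟨adGen j, Algebra.subset_adjoin ⟨j, rfl⟩⟩ : adAlgebra K d))

open scoped IsMulCommutative in
theorem polyAct_X (j : Fin d) : polyAct (K := K) (MvPolynomial.X j) = adGen j := by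
  simp [polyAct]

open MvPolynomial in
/-- The element `∑ p_ij(ad x) ⁅x_i, x_j⁆` of the derived ideal. -/
def commSum : (Fin d → Fin d → MvPolynomial (Fin d) K) →ₗ[K] derivedIdeal K d where
  toFun p := ∑ i, ∑ j, polyAct (p i j) (comm (gen i) (gen j))
  map_add' p q := by simp [Finset.sum_add_distrib]
  map_smul' c p := by simp [Finset.smul_sum]

theorem commSum_apply (p : Fin d → Fin d → MvPolynomial (Fin d) K) :
    commSum p = ∑ i, ∑ j, polyAct (p i j) (comm (gen i) (gen j)) := rfl

theorem adGen_commSum (l : Fin d) (p : Fin d → Fin d → MvPolynomial (Fin d) K) :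
    adGen l (commSum p) = commSum fun i j => MvPolynomial.X l * p i j := by
  simp [commSum_apply, polyAct_X]

theorem exists_lie_lin_commSum (w : Fin d →₀ K) (p : Fin d → Fin d → MvPolynomial (Fin d) K) :
    ∃ q, ((commSum q : derivedIdeal K d) : FreeMetabelian K d) =
      ⁅lin w, ((commSum p : derivedIdeal K d) : FreeMetabelian K d)⁆ := by
  refine ⟨∑ l, w l • fun i j => MvPolynomial.X l * p i j, ?_⟩
  rw [lin_eq_sum, sum_lie, map_sum]
  simp only [map_smul, smul_lie, ← adGen_commSum]
  simp [adGen_apply]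

theorem exists_lie_lin_lin (w w' : Fin d →₀ K) :
    ∃ q, ((commSum q : derivedIdeal K d) : FreeMetabelian K d) = ⁅lin w, lin w'⁆ := by
  refine ⟨fun i j => MvPolynomial.C (w i * w' j), ?_⟩
  simp only [lin_eq_sum, sum_lie, lie_sum, commSum_apply,
    smul_lie, lie_smul]
  simp only [← MvPolynomial.algebraMap_eq, AlgHom.commutes, Module.algebraMap_end_apply,
    AddSubmonoidClass.coe_finsetSum, LieSubmodule.coe_smul, comm, Finset.smul_sum]
  rw [Finset.sum_comm]
  refine Finset.sum_congr rfl fun i _ => Finset.sum_congr rfl fun j _ => ?_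
  rw [mul_comm, mul_smul]

/-- Every element of `F_d` is the sum of a linear element and of an element of the derived ideal
of the form `∑ p_ij(ad x) ⁅x_i, x_j⁆`. -/
theorem exists_normal_form (f : FreeMetabelian K d) :
    ∃ w p, f = lin w + ((commSum p : derivedIdeal K d) : FreeMetabelian K d) := by
  let A : LieSubalgebra K (FreeMetabelian K d) :=
    { carrier := {f | ∃ w p, f = lin w + ((commSum p : derivedIdeal K d) : FreeMetabelian K d)}
      add_mem' := by
        rintro _ _ ⟨w, p, rfl⟩ ⟨w', p', rfl⟩
        refine ⟨w + w', p + p', ?_⟩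
        rw [map_add, map_add]
        push_cast
        abel
      zero_mem' := ⟨0, 0, by simp⟩
      smul_mem' := by
        rintro c _ ⟨w, p, rfl⟩
        exact ⟨c • w, c • p, by simp⟩
      lie_mem' := by
        rintro _ _ ⟨w, p, rfl⟩ ⟨w', p', rfl⟩
        obtain ⟨q₁, h₁⟩ := exists_lie_lin_lin w w'
        obtain ⟨q₂, h₂⟩ := exists_lie_lin_commSum w p'
        obtain ⟨q₃, h₃⟩ := exists_lie_lin_commSum w' p
        refine ⟨0, q₁ + q₂ - q₃, ?_⟩
        rw [map_zero, map_sub, map_add, lie_add, add_lie, add_lie, lie_derived, ← h₁, ← h₂,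
          ← lie_skew, ← h₃]
        push_cast
        abel }
  exact mem_of_gen_mem A (fun j => ⟨Finsupp.single j 1, 0, by simp [gen]⟩) f

/-- The Koszul homotopy: `x_j ⊗ q ↦ ∑ (∂_l q)(ad x) ⁅x_l, x_j⁆`. -/
def homotopy (j : Fin d) : MvPolynomial (Fin d) K →ₗ[K] derivedIdeal K d where
  toFun q := ∑ l, polyAct (MvPolynomial.pderiv l q) (comm (gen l) (gen j))
  map_add' p q := by simp [Finset.sum_add_distrib]
  map_smul' c p := by simp [Finset.smul_sum]

theorem homotopy_apply (j : Fin d) (q : MvPolynomial (Fin d) K) :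
    homotopy j q = ∑ l, polyAct (MvPolynomial.pderiv l q) (comm (gen l) (gen j)) := rfl

theorem comm_swap (x y : FreeMetabelian K d) : comm x y = -comm y x := by
  ext
  simp [comm]

theorem adGen_jacobi (i j l : Fin d) :
    (adGen i (comm (gen l) (gen j)) : derivedIdeal K d) - adGen j (comm (gen l) (gen i)) =
      adGen l (comm (gen i) (gen j)) := by
  ext
  simp only [AddSubgroupClass.coe_sub, adGen_apply, comm]
  rw [leibniz_lie (gen l), ← lie_skew (gen j) (⁅gen l, gen i⁆ : FreeMetabelian K d)]
  rw [← lie_skew (gen l) (gen i), ← lie_skew (gen l) (gen j)]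
  simp

open MvPolynomial in
/-- The homotopy recovers `p(ad x) ⁅x_i, x_j⁆`, up to the factor `deg p + 2`, from its image
`p (x_i ⊗ t_j - x_j ⊗ t_i)` under the Koszul differential: this is Euler's identity combined with
the Jacobi identity. -/
theorem homotopy_koszul {n : ℕ} {p : MvPolynomial (Fin d) K} (hp : p.IsHomogeneous n)
    (i j : Fin d) :
    homotopy j (X i * p) - homotopy i (X j * p) =
      ((n + 2 : ℕ) : K) • polyAct p (comm (gen i) (gen j)) := by
  have key : ∀ i j : Fin d, homotopy j (X i * p) = polyAct p (comm (gen i) (gen j)) +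
      ∑ l, polyAct (pderiv l p) (adGen i (comm (gen l) (gen j))) := by
    intro i j
    simp only [homotopy_apply, Derivation.leibniz, pderiv_X, smul_eq_mul, map_add, map_mul,
      LinearMap.add_apply, Finset.sum_add_distrib]
    rw [add_comm]
    congr 1
    · rw [Finset.sum_eq_single i]
      · simp
      · intro l _ hl
        simp [hl.symm]
      · simp
    · refine Finset.sum_congr rfl fun l _ => ?_
      rw [← map_mul, mul_comm, map_mul, polyAct_X, Module.End.mul_apply]
  have euler : ∑ l, polyAct (pderiv l p) (adGen l (comm (gen i) (gen j))) =
      (n : K) • polyAct p (comm (gen i) (gen j)) := by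
    have h := congrArg (fun q => polyAct q (comm (gen i) (gen j))) hp.sum_X_mul_pderiv
    simp only [map_sum, map_nsmul, LinearMap.sum_apply, LinearMap.smul_apply] at h
    rw [Nat.cast_smul_eq_nsmul, ← h]
    refine Finset.sum_congr rfl fun l _ => ?_
    rw [mul_comm, map_mul, polyAct_X, Module.End.mul_apply]
  rw [key, key, comm_swap (gen j) (gen i), map_neg]
  have : ∑ l, polyAct (pderiv l p) (adGen i (comm (gen l) (gen j))) -
      ∑ l, polyAct (pderiv l p) (adGen j (comm (gen l) (gen i))) =
      (n : K) • polyAct p (comm (gen i) (gen j)) := by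
    rw [← euler, ← Finset.sum_sub_distrib]
    refine Finset.sum_congr rfl fun l _ => ?_
    rw [← map_sub, adGen_jacobi]
  push_cast
  rw [add_smul, ← this, two_smul]
  abel

open MvPolynomial in
theorem homogeneousComponent_X_mul {σ R : Type*} [CommSemiring R] (n : ℕ) (i : σ)
    (p : MvPolynomial σ R) :
    homogeneousComponent (n + 1) (X i * p) = X i * homogeneousComponent n p := by
  classical
  ext m
  rw [coeff_homogeneousComponent, coeff_X_mul', coeff_X_mul', coeff_homogeneousComponent]
  by_cases hi : i ∈ m.support
  · have h : m = (m - Finsupp.single i 1) + Finsupp.single i 1 := by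
      rw [tsub_add_cancel_of_le]
      rw [Finsupp.single_le_iff]
      exact Nat.one_le_iff_ne_zero.2 (Finsupp.mem_support_iff.1 hi)
    have h' : m.degree = (m - Finsupp.single i 1).degree + 1 := by
      conv_lhs => rw [h]
      simp
    simp [hi, h']
  · simp [hi]

open MvPolynomial in
/-- Exactness of the Koszul complex: an element `∑ p_ij(ad x) ⁅x_i, x_j⁆` vanishes as soon as its
image `∑ p_ij (x_i ⊗ t_j - x_j ⊗ t_i)` vanishes. -/
theorem commSum_eq_zero [CharZero K] (p : Fin d → Fin d → MvPolynomial (Fin d) K)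
    (hp : ∀ j, ∑ i, X i * p i j = ∑ i, X i * p j i) : commSum p = 0 := by
  have hom : ∀ n : ℕ, commSum (fun i j => homogeneousComponent n (p i j)) = 0 := by
    intro n
    have h : ∀ j, ∑ i, X i * homogeneousComponent n (p i j) =
        ∑ i, X i * homogeneousComponent n (p j i) := by
      intro j
      simpa only [map_sum, homogeneousComponent_X_mul] using
        congrArg (homogeneousComponent (n + 1)) (hp j)
    have h2 : ((n + 2 : ℕ) : K) • commSum (fun i j => homogeneousComponent n (p i j)) = 0 := by
      rw [commSum_apply, Finset.smul_sum]
      simp only [Finset.smul_sum]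
      simp only [← homotopy_koszul (homogeneousComponent_isHomogeneous n _),
        Finset.sum_sub_distrib]
      rw [Finset.sum_comm, sub_eq_zero]
      simp only [← map_sum, h]
    exact (smul_eq_zero.1 h2).resolve_left (Nat.cast_ne_zero.2 (by omega))
  have hN : ∃ N, ∀ i j, (p i j).totalDegree < N := by
    refine ⟨∑ i, ∑ j, (p i j).totalDegree + 1, fun i j => Nat.lt_succ_of_le ?_⟩
    exact (Finset.single_le_sum (f := fun j => (p i j).totalDegree) (by simp)
      (Finset.mem_univ j)).trans (Finset.single_le_sum (f := fun i => ∑ j, (p i j).totalDegree)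
      (by simp) (Finset.mem_univ i))
  obtain ⟨N, hN⟩ := hN
  have hsum : p = ∑ n ∈ Finset.range N, fun i j => homogeneousComponent n (p i j) := by
    funext i j
    rw [Finset.sum_apply, Finset.sum_apply]
    conv_lhs => rw [← sum_homogeneousComponent (p i j)]
    refine Finset.sum_subset (Finset.range_subset_range.2 (hN i j)) fun n _ hn => ?_
    exact homogeneousComponent_eq_zero _ _ (by simpa using hn)
  rw [hsum, map_sum]
  exact Finset.sum_eq_zero fun n _ => hom n

end Structure

/-! ### Faithfulness of the functionals -/

section Faithful

variable {K : Type*} [Field K] {d : ℕ}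

/-- The value at `τ` of a polynomial in the coordinates of the dual space of `KX_d`. -/
def ev (τ : Module.Dual K (Fin d →₀ K)) : MvPolynomial (Fin d) K →ₐ[K] K :=
  MvPolynomial.aeval fun j => τ (Finsupp.single j 1)

@[simp] theorem ev_X (τ : Module.Dual K (Fin d →₀ K)) (j : Fin d) :
    ev τ (MvPolynomial.X j) = τ (Finsupp.single j 1) := by
  simp [ev]

@[simp] theorem ev_C (τ : Module.Dual K (Fin d →₀ K)) (c : K) :
    ev τ (MvPolynomial.C c) = c := by
  simp [ev]

/-- The functional on `KX_d` with prescribed values on the basis. -/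
def dualOf (x : Fin d → K) : Module.Dual K (Fin d →₀ K) :=
  Finsupp.linearCombination K x

@[simp] theorem dualOf_single (x : Fin d → K) (j : Fin d) :
    dualOf x (Finsupp.single j 1) = x j := by
  simp [dualOf]

theorem eq_of_ev_eq [Infinite K] {p q : MvPolynomial (Fin d) K} (h : ∀ τ, ev τ p = ev τ q) :
    p = q := by
  refine MvPolynomial.funext fun x => ?_
  simpa [ev, MvPolynomial.aeval_eq_eval] using h (dualOf x)

theorem phi_polyAct (σ τ : Module.Dual K (Fin d →₀ K)) (p : MvPolynomial (Fin d) K)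
    (z : derivedIdeal K d) (hz : (phi σ τ z).1 = 0) :
    phi σ τ (polyAct p z : derivedIdeal K d) = Aff.of 0 (ev τ p * (phi σ τ z).2) := by
  induction p using MvPolynomial.induction_on with
  | C c =>
    rw [← MvPolynomial.algebraMap_eq, AlgHom.commutes, AlgHom.commutes,
      Module.algebraMap_end_apply, LieSubmodule.coe_smul, map_smul]
    ext <;> simp [hz]
  | add p q hp hq =>
    rw [map_add, LinearMap.add_apply, LieSubmodule.coe_add, map_add, hp, hq]
    ext <;> simp [add_mul]
  | mul_X p j hp =>
    rw [mul_comm, map_mul, Module.End.mul_apply, polyAct_X, adGen_apply, LieHom.map_lie, hp,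
      phi_gen]
    ext <;> simp [mul_assoc]

theorem phi_commSum (σ τ : Module.Dual K (Fin d →₀ K))
    (p : Fin d → Fin d → MvPolynomial (Fin d) K) :
    phi σ τ (commSum p : derivedIdeal K d) = Aff.of 0 (∑ i, ∑ j, ev τ (p i j) *
      (τ (Finsupp.single i 1) * σ (Finsupp.single j 1) -
        τ (Finsupp.single j 1) * σ (Finsupp.single i 1))) := by
  have h : ∀ i j, phi σ τ (comm (gen i) (gen j) : derivedIdeal K d) = Aff.of 0
      (τ (Finsupp.single i 1) * σ (Finsupp.single j 1) -
        τ (Finsupp.single j 1) * σ (Finsupp.single i 1)) := by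
    intro i j
    simp only [comm, LieHom.map_lie, phi_gen]
    rfl
  have h' : ∀ i j, phi σ τ (polyAct (p i j) (comm (gen i) (gen j)) : derivedIdeal K d) =
      Aff.of 0 (ev τ (p i j) * (τ (Finsupp.single i 1) * σ (Finsupp.single j 1) -
        τ (Finsupp.single j 1) * σ (Finsupp.single i 1))) := by
    intro i j
    rw [phi_polyAct _ _ _ _ (by rw [h]; rfl), h]
    rfl
  simp only [commSum_apply, AddSubmonoidClass.coe_finsetSum, map_sum, h']
  ext
  · simp [Aff.sum_fst]
  · simp [Aff.sum_snd]

/-- The functionals `phi σ τ` separate the points of `F_d`. -/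
theorem eq_zero_of_phi [CharZero K] {f : FreeMetabelian K d} (h : ∀ σ τ, phi σ τ f = 0) :
    f = 0 := by
  obtain ⟨w, p, rfl⟩ := exists_normal_form f
  have hw : w = 0 := by
    ext j
    have := congrArg Prod.fst (h 0 (Finsupp.lapply j))
    rw [map_add, phi_lin, phi_commSum] at this
    simpa using this
  have hp : commSum p = 0 := by
    refine commSum_eq_zero p fun j => eq_of_ev_eq fun τ => ?_
    have := congrArg Prod.snd (h (Finsupp.lapply j) τ)
    rw [hw, map_zero, zero_add, phi_commSum] at this
    simp [Finsupp.single_apply, mul_sub, Finset.sum_sub_distrib, sub_eq_zero] at this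
    simp only [map_sum, map_mul, ev_X]
    simpa only [mul_comm] using this
  rw [hw, hp]
  simp

theorem eq_of_phi [CharZero K] {f g : FreeMetabelian K d} (h : ∀ σ τ, phi σ τ f = phi σ τ g) :
    f = g := by
  rw [← sub_eq_zero]
  refine eq_zero_of_phi fun σ τ => ?_
  rw [map_sub, h, sub_self]

/-- The value at `(σ, τ)` of the polynomial covector field `∑ q_j(τ) σ_j`. -/
def fieldEv (σ τ : Module.Dual K (Fin d →₀ K)) (q : Fin d → MvPolynomial (Fin d) K) : K :=
  ∑ j, σ (Finsupp.single j 1) * ev τ (q j)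

theorem fieldEv_add_left (σ σ' τ : Module.Dual K (Fin d →₀ K))
    (q : Fin d → MvPolynomial (Fin d) K) :
    fieldEv (σ + σ') τ q = fieldEv σ τ q + fieldEv σ' τ q := by
  simp [fieldEv, add_mul, Finset.sum_add_distrib]

theorem fieldEv_smul_left (c : K) (σ τ : Module.Dual K (Fin d →₀ K))
    (q : Fin d → MvPolynomial (Fin d) K) :
    fieldEv (c • σ) τ q = c * fieldEv σ τ q := by
  simp [fieldEv, Finset.mul_sum, mul_assoc]

theorem fieldEv_add_right (σ τ : Module.Dual K (Fin d →₀ K))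
    (q q' : Fin d → MvPolynomial (Fin d) K) :
    fieldEv σ τ (q + q') = fieldEv σ τ q + fieldEv σ τ q' := by
  simp [fieldEv, mul_add, Finset.sum_add_distrib]

/-- Every element of `F_d` is given by a vector `w` and by a polynomial covector field that
vanishes on the diagonal. -/
theorem exists_phi_eq (f : FreeMetabelian K d) : ∃ (w : Fin d →₀ K)
    (q : Fin d → MvPolynomial (Fin d) K),
    (∀ σ τ, phi σ τ f = Aff.of (τ w) (σ w + fieldEv σ τ q)) ∧ ∀ τ, fieldEv τ τ q = 0 := by
  obtain ⟨w, p, rfl⟩ := exists_normal_form f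
  have key : ∀ σ τ, fieldEv σ τ (fun j => ∑ i, MvPolynomial.X i * (p i j - p j i)) =
      ∑ i, ∑ j, ev τ (p i j) * (τ (Finsupp.single i 1) * σ (Finsupp.single j 1) -
        τ (Finsupp.single j 1) * σ (Finsupp.single i 1)) := by
    intro σ τ
    simp only [fieldEv, map_sum, map_mul, ev_X, map_sub, mul_sub, Finset.mul_sum,
      Finset.sum_sub_distrib]
    rw [Finset.sum_comm]
    congr 1
    · exact Finset.sum_congr rfl fun i _ => Finset.sum_congr rfl fun j _ => by ring
    · exact Finset.sum_congr rfl fun i _ => Finset.sum_congr rfl fun j _ => by ring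
  refine ⟨w, fun j => ∑ i, MvPolynomial.X i * (p i j - p j i), fun σ τ => ?_, fun τ => ?_⟩
  · rw [map_add, phi_lin, phi_commSum, key]
    ext <;> simp
  · rw [key]
    refine Finset.sum_eq_zero fun i _ => Finset.sum_eq_zero fun j _ => ?_
    ring

/-- A subalgebra that contains the image of an endomorphism `E` of `KX_d` allows multiplication of
its elements of the derived ideal with polynomials in `τ ∘ₗ E`. -/
theorem exists_mem_mul {A : LieSubalgebra K (FreeMetabelian K d)} {E : Module.End K (Fin d →₀ K)}
    (hE : ∀ w, lin (E w) ∈ A) (θ : Module.Dual K (Fin d →₀ K)) (p : MvPolynomial (Fin d) K)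
    {z : FreeMetabelian K d} (hzA : z ∈ A)
    {χ : Module.Dual K (Fin d →₀ K) → Module.Dual K (Fin d →₀ K) → K}
    (hz : ∀ σ τ, phi σ τ z = Aff.of 0 (χ σ τ)) :
    ∃ z' ∈ A, ∀ σ τ, phi σ τ z' = Aff.of 0 (ev (θ + τ ∘ₗ E) p * χ σ τ) := by
  induction p using MvPolynomial.induction_on with
  | C c =>
    refine ⟨c • z, A.smul_mem c hzA, fun σ τ => ?_⟩
    rw [map_smul, hz]
    ext <;> simp
  | add p q hp hq =>
    obtain ⟨z₁, hA₁, h₁⟩ := hp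
    obtain ⟨z₂, hA₂, h₂⟩ := hq
    refine ⟨z₁ + z₂, A.add_mem hA₁ hA₂, fun σ τ => ?_⟩
    rw [map_add, h₁, h₂]
    ext <;> simp [add_mul]
  | mul_X p j hp =>
    obtain ⟨z₁, hA₁, h₁⟩ := hp
    refine ⟨θ (Finsupp.single j 1) • z₁ + ⁅lin (E (Finsupp.single j 1)), z₁⁆,
      A.add_mem (A.smul_mem _ hA₁) (A.lie_mem (hE _) hA₁), fun σ τ => ?_⟩
    rw [map_add, map_smul, LieHom.map_lie, h₁, phi_lin]
    ext <;> simp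
    ring

/-- The derived ideal is stable under multiplication with polynomials in `τ`. -/
theorem exists_mul (p : MvPolynomial (Fin d) K) {z : FreeMetabelian K d}
    {χ : Module.Dual K (Fin d →₀ K) → Module.Dual K (Fin d →₀ K) → K}
    (hz : ∀ σ τ, phi σ τ z = Aff.of 0 (χ σ τ)) :
    ∃ z', ∀ σ τ, phi σ τ z' = Aff.of 0 (ev τ p * χ σ τ) := by
  obtain ⟨z', -, h⟩ := exists_mem_mul (A := ⊤) (E := LinearMap.id)
    (fun _ => LieSubalgebra.mem_top _) 0 p (LieSubalgebra.mem_top z) hz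
  exact ⟨z', by simpa using h⟩

/-- Two covector fields give an element of the derived ideal, by the Koszul relation. -/
theorem exists_koszul (q q' : Fin d → MvPolynomial (Fin d) K) :
    ∃ z : FreeMetabelian K d, ∀ σ τ, phi σ τ z = Aff.of 0
      (fieldEv τ τ q * fieldEv σ τ q' - fieldEv σ τ q * fieldEv τ τ q') := by
  refine ⟨(commSum (fun i j => q i * q' j) : derivedIdeal K d), fun σ τ => ?_⟩
  rw [phi_commSum]
  congr 1
  simp only [fieldEv, Finset.sum_mul_sum, map_mul, ← Finset.sum_sub_distrib]
  exact Finset.sum_congr rfl fun i _ => Finset.sum_congr rfl fun j _ => by ring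

/-- The restriction of a polynomial function to a line is a polynomial. -/
theorem exists_ev_line (p : MvPolynomial (Fin d) K) (τ₀ τ₁ : Module.Dual K (Fin d →₀ K)) :
    ∃ P : Polynomial K, ∀ s : K, ev (τ₀ + s • τ₁) p = P.eval s := by
  refine ⟨MvPolynomial.aeval (fun j => Polynomial.C (τ₀ (Finsupp.single j 1)) +
    Polynomial.C (τ₁ (Finsupp.single j 1)) * Polynomial.X) p, fun s => ?_⟩
  induction p using MvPolynomial.induction_on with
  | C c => simp
  | add p q hp hq => simp [hp, hq]
  | mul_X p j hp => simp [hp, mul_comm s]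

theorem exists_fieldEv_line (q : Fin d → MvPolynomial (Fin d) K)
    (σ₀ σ₁ τ₀ τ₁ : Module.Dual K (Fin d →₀ K)) :
    ∃ P : Polynomial K, ∀ s : K, fieldEv (σ₀ + s • σ₁) (τ₀ + s • τ₁) q = P.eval s := by
  choose P hP using fun j => exists_ev_line (q j) τ₀ τ₁
  refine ⟨∑ j, (Polynomial.C (σ₀ (Finsupp.single j 1)) +
    Polynomial.C (σ₁ (Finsupp.single j 1)) * Polynomial.X) * P j, fun s => ?_⟩
  simp [fieldEv, Polynomial.eval_finsetSum, hP, mul_comm s]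

end Faithful

/-! ### A criterion for infinite generation -/

section Criterion

variable {K : Type*} [Field K] [CharZero K] {d : ℕ} {G : Type*} [Group G]

/-- Invariance in `F_d` can be tested on the functionals `phi σ τ`. -/
theorem mem_invariants_iff (ρ : Representation K G (Fin d →₀ K)) (f : FreeMetabelian K d) :
    f ∈ invariants ρ ↔ ∀ g σ τ, phi (σ ∘ₗ ρ g) (τ ∘ₗ ρ g) f = phi σ τ f := by
  refine ⟨fun h g σ τ => ?_, fun h g => eq_of_phi fun σ τ => ?_⟩
  · rw [← phi_map, h g]
  · rw [phi_map, h]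

/-- The linear part of an invariant element is an invariant vector. -/
theorem apply_eq_of_mem_invariants {ρ : Representation K G (Fin d →₀ K)}
    {f : FreeMetabelian K d} (hf : f ∈ invariants ρ) {w : Fin d →₀ K}
    (hw : ∀ σ τ, (phi σ τ f).1 = τ w) (g : G) : ρ g w = w := by
  ext j
  have h := congrArg Prod.fst ((mem_invariants_iff ρ f).1 hf g 0 (Finsupp.lapply j))
  have h' := h
  rw [hw, hw] at h'
  exact h'

open Polynomial in
/-- If some invariant element of the derived ideal can be multiplied by an invariant polynomial
whose degree along a curve `s ↦ τ ∘ (E₀ + s E₁)` is positive, where `E₀ + s E₁` fixes all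
invariant vectors, then the algebra of invariants is not finitely generated: the degree in `s` is
bounded on every finitely generated subalgebra of the invariants, but not on the products of the
given element with the powers of the polynomial. -/
theorem not_isFinitelyGenerated (ρ : Representation K G (Fin d →₀ K))
    (E₀ E₁ : Module.End K (Fin d →₀ K)) (hE : E₀ + E₁ = 1)
    (hfix : ∀ w, (∀ g, ρ g w = w) → ∀ s : K, (E₀ + s • E₁) w = w)
    (p : MvPolynomial (Fin d) K) (hp : ∀ g τ, ev (τ ∘ₗ ρ g) p = ev τ p)
    {z : FreeMetabelian K d} (hz : z ∈ invariants ρ)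
    {χ : Module.Dual K (Fin d →₀ K) → Module.Dual K (Fin d →₀ K) → K}
    (hχ : ∀ σ τ, phi σ τ z = Aff.of 0 (χ σ τ)) (σ τ : Module.Dual K (Fin d →₀ K))
    (hp₀ : ev (τ ∘ₗ E₀) p = 0) (hp₁ : ev τ p ≠ 0) (hχ₁ : χ σ τ ≠ 0) :
    ¬ IsFinitelyGenerated (invariants ρ) := by
  rintro ⟨S, hS⟩
  set σs : K → Module.Dual K (Fin d →₀ K) := fun s => σ ∘ₗ E₀ + s • (σ ∘ₗ E₁) with hσs
  set τs : K → Module.Dual K (Fin d →₀ K) := fun s => τ ∘ₗ E₀ + s • (τ ∘ₗ E₁) with hτs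
  have hσ1 : σs 1 = σ := by
    simp only [hσs, one_smul, ← LinearMap.comp_add, hE]
    rfl
  have hτ1 : τs 1 = τ := by
    simp only [hτs, one_smul, ← LinearMap.comp_add, hE]
    rfl
  -- every element is polynomial along the curve
  have hpoly : ∀ f : FreeMetabelian K d, ∃ P : K[X], ∀ s, (phi (σs s) (τs s) f).2 = P.eval s := by
    intro f
    obtain ⟨w, q, h, -⟩ := exists_phi_eq f
    obtain ⟨P, hP⟩ := exists_fieldEv_line q (σ ∘ₗ E₀) (σ ∘ₗ E₁) (τ ∘ₗ E₀) (τ ∘ₗ E₁)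
    refine ⟨C (σ (E₀ w)) + C (σ (E₁ w)) * X + P, fun s => ?_⟩
    rw [h, Aff.of_snd, hP]
    simp [hσs, mul_comm s]
  have hlam : ∀ f ∈ invariants ρ, ∀ s, (phi (σs s) (τs s) f).1 = (phi σ τ f).1 := by
    intro f hf s
    obtain ⟨w, q, h, -⟩ := exists_phi_eq f
    have hw := hfix w (fun g => apply_eq_of_mem_invariants hf (fun σ τ => by rw [h]; rfl) g) s
    rw [h, h, Aff.of_fst, Aff.of_fst]
    conv_rhs => rw [← hw]
    simp [hτs]
  let A : ℕ → LieSubalgebra K (FreeMetabelian K d) := fun N =>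
    { carrier := {f | (∀ s, (phi (σs s) (τs s) f).1 = (phi σ τ f).1) ∧
        ∃ P : K[X], P.natDegree ≤ N ∧ ∀ s, (phi (σs s) (τs s) f).2 = P.eval s}
      add_mem' := by
        rintro a b ⟨ha, P, hP, haP⟩ ⟨hb, Q, hQ, hbQ⟩
        refine ⟨fun s => ?_, P + Q, natDegree_add_le_of_degree_le hP hQ, fun s => ?_⟩
        · simp [ha s, hb s]
        · simp [haP s, hbQ s]
      zero_mem' := ⟨fun s => by simp, 0, by simp, fun s => by simp⟩
      smul_mem' := by
        rintro c a ⟨ha, P, hP, haP⟩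
        refine ⟨fun s => ?_, C c * P, (natDegree_C_mul_le _ _).trans hP, fun s => ?_⟩
        · simp [ha s]
        · simp [haP s]
      lie_mem' := by
        rintro a b ⟨ha, P, hP, haP⟩ ⟨hb, Q, hQ, hbQ⟩
        refine ⟨fun s => ?_, C (phi σ τ a).1 * Q - C (phi σ τ b).1 * P, ?_, fun s => ?_⟩
        · simp
        · exact (natDegree_sub_le _ _).trans
            (max_le ((natDegree_C_mul_le _ _).trans hQ) ((natDegree_C_mul_le _ _).trans hP))
        · simp [ha s, hb s, haP s, hbQ s] }
  obtain ⟨N, hN⟩ : ∃ N, invariants ρ ≤ A N := by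
    choose P hP using hpoly
    refine ⟨S.sup fun f => (P f).natDegree, ?_⟩
    rw [← hS, LieSubalgebra.lieSpan_le]
    intro f hf
    have hf' : f ∈ invariants ρ := by
      rw [← hS]
      exact LieSubalgebra.subset_lieSpan hf
    exact ⟨hlam f hf', P f, Finset.le_sup (f := fun f => (P f).natDegree) hf, hP f⟩
  obtain ⟨z', hz'⟩ := exists_mul (p ^ (N + 1)) hχ
  have hinv : z' ∈ invariants ρ := by
    rw [mem_invariants_iff] at hz ⊢
    intro g σ' τ'
    have h := hz g σ' τ'
    rw [hχ, hχ] at h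
    rw [hz', hz', map_pow, map_pow, hp]
    congr 2
    exact congrArg Prod.snd h
  obtain ⟨-, P, hP, hzP⟩ := hN hinv
  obtain ⟨Q, hQ⟩ := exists_ev_line p (τ ∘ₗ E₀) (τ ∘ₗ E₁)
  obtain ⟨R, hR⟩ := hpoly z
  have heq : P = Q ^ (N + 1) * R := by
    refine Polynomial.funext fun s => ?_
    rw [← hzP, hz', Aff.of_snd, map_pow, hQ, eval_mul, eval_pow, ← hR, hχ, Aff.of_snd]
  have hR0 : R ≠ 0 := by
    rintro rfl
    have := hR 1
    rw [hσ1, hτ1, hχ] at this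
    exact hχ₁ (by simpa using this)
  have hQ0 : Q.eval 0 = 0 := by
    rw [← hQ 0, zero_smul, add_zero, hp₀]
  have hQ1 : Q.eval 1 ≠ 0 := by
    rw [← hQ 1]
    change ev (τs 1) p ≠ 0
    rwa [hτ1]
  have hQd : 1 ≤ Q.natDegree := by
    by_contra h
    have h0 : Q.natDegree = 0 := by omega
    rw [eq_C_of_natDegree_eq_zero h0] at hQ0 hQ1
    rw [eval_C] at hQ0 hQ1
    exact hQ1 hQ0
  have hQne : Q ≠ 0 := by
    rintro rfl
    simp at hQ1
  rw [heq, natDegree_mul (pow_ne_zero _ hQne) hR0, natDegree_pow] at hP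
  nlinarith

end Criterion

/-! ### Symbolic method: multilinear forms on the duals of the spaces of binary forms -/

section Symbolic

variable {K : Type*} [Field K]

variable (K) in
/-- The space `V_k` of binary forms of degree `k`. -/
abbrev Forms (k : ℕ) : Type _ := MvPolynomial.homogeneousSubmodule (Fin 2) K k

/-- Evaluation of binary forms of degree `k` at a point of the plane. -/
def evalAt (k : ℕ) (v : Fin 2 → K) : Module.Dual K (Forms K k) :=
  (MvPolynomial.aeval v).toLinearMap ∘ₗ (MvPolynomial.homogeneousSubmodule (Fin 2) K k).subtype

theorem evalAt_apply (k : ℕ) (v : Fin 2 → K) (h : Forms K k) :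
    evalAt k v h = MvPolynomial.aeval v (h : MvPolynomial (Fin 2) K) := rfl

theorem evalAt_comp (k : ℕ) (v : Fin 2 → K) (g : SL(2, K)) :
    evalAt k v ∘ₗ binaryForms K k g = evalAt k ((g⁻¹).1.mulVec v) := by
  ext h
  change MvPolynomial.aeval v (polyAction K g (h : MvPolynomial (Fin 2) K)) =
    MvPolynomial.aeval _ (h : MvPolynomial (Fin 2) K)
  rw [← AlgHom.comp_apply]
  congr 1
  apply MvPolynomial.algHom_ext
  intro i
  rw [AlgHom.comp_apply, polyAction_X]
  simp only [Matrix.mulVec, dotProduct, map_sum, map_mul, MvPolynomial.aeval_X,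
    MvPolynomial.algHom_C, Algebra.algebraMap_self, RingHom.id_apply]

instance (k : ℕ) : Module.Finite K (Forms K k) :=
  Module.Finite.iff_fg.2 (MvPolynomial.homogeneousSubmodule_fg (R := K) (σ := Fin 2) k)

/-- The evaluations at points span the dual of the space of binary forms. -/
theorem span_range_evalAt [Infinite K] (k : ℕ) :
    Submodule.span K (Set.range (evalAt (K := K) k)) = ⊤ := by
  refine Submodule.span_eq_top_of_ne_zero fun h hh => ?_
  by_contra! hc
  refine hh (Subtype.ext (MvPolynomial.funext fun v => ?_))
  have := hc _ ⟨v, rfl⟩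
  rw [evalAt_apply, MvPolynomial.aeval_eq_eval] at this
  simpa using this

/-- The space of multihomogeneous polynomial functions of multidegree `κ` in `n` points of the
plane. -/
def multiform (K : Type*) [Field K] {n : ℕ} (κ : Fin n → ℕ) :
    Submodule K ((Fin n → Fin 2 → K) → K) :=
  Submodule.span K {P | ∃ h : Fin n → MvPolynomial (Fin 2) K, (∀ v, (h v).IsHomogeneous (κ v)) ∧
    P = fun u => ∏ v, MvPolynomial.aeval (u v) (h v)}

theorem mul_mem_multiform {n : ℕ} {κ κ' : Fin n → ℕ} {P Q : (Fin n → Fin 2 → K) → K}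
    (hP : P ∈ multiform K κ) (hQ : Q ∈ multiform K κ') : P * Q ∈ multiform K (κ + κ') := by
  have h := Submodule.mul_mem_mul hP hQ
  rw [multiform, multiform, Submodule.span_mul_span] at h
  refine Submodule.span_mono ?_ h
  rintro _ ⟨_, ⟨h, hh, rfl⟩, _, ⟨h', hh', rfl⟩, rfl⟩
  refine ⟨h * h', fun v => (hh v).mul (hh' v), ?_⟩
  funext u
  simp [Finset.prod_mul_distrib]

theorem one_mem_multiform {n : ℕ} : (1 : (Fin n → Fin 2 → K) → K) ∈ multiform K (0 : Fin n → ℕ) :=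
  Submodule.subset_span ⟨1, fun _ => MvPolynomial.isHomogeneous_one _ _, by funext u; simp⟩

theorem pow_mem_multiform {n : ℕ} {κ : Fin n → ℕ} {P : (Fin n → Fin 2 → K) → K}
    (hP : P ∈ multiform K κ) (m : ℕ) : P ^ m ∈ multiform K (m • κ) := by
  induction m with
  | zero => simpa using one_mem_multiform
  | succ m ih =>
    rw [pow_succ, succ_nsmul]
    exact mul_mem_multiform ih hP

theorem coord_mem_multiform {n : ℕ} (i : Fin n) (a : Fin 2) :
    (fun u => u i a : (Fin n → Fin 2 → K) → K) ∈ multiform K (Pi.single i 1) := by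
  refine Submodule.subset_span ⟨fun v => if v = i then MvPolynomial.X a else 1, fun v => ?_, ?_⟩
  · by_cases h : v = i
    · subst h
      simpa using MvPolynomial.isHomogeneous_X K a
    · simpa [h] using MvPolynomial.isHomogeneous_one (Fin 2) K
  · funext u
    rw [Finset.prod_eq_single i] <;> simp +contextual

/-- The symbolic bracket: the determinant of the `i`-th and `j`-th of `n` points of the plane. -/
def bracket {n : ℕ} (i j : Fin n) (u : Fin n → Fin 2 → K) : K :=
  u i 0 * u j 1 - u i 1 * u j 0

theorem bracket_mem_multiform {n : ℕ} (i j : Fin n) :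
    (bracket i j : (Fin n → Fin 2 → K) → K) ∈
      multiform K (Pi.single i 1 + Pi.single j 1 : Fin n → ℕ) :=
  sub_mem (mul_mem_multiform (coord_mem_multiform i 0) (coord_mem_multiform j 1))
    (mul_mem_multiform (coord_mem_multiform i 1) (coord_mem_multiform j 0))

theorem bracket_pow_mem_multiform {n : ℕ} (i j : Fin n) (m : ℕ) :
    (bracket i j ^ m : (Fin n → Fin 2 → K) → K) ∈
      multiform K (m • (Pi.single i 1 + Pi.single j 1 : Fin n → ℕ)) :=
  pow_mem_multiform (bracket_mem_multiform i j) m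

/-- A function of `n` points of the plane is invariant under `SL₂(K)`. -/
def IsSLInvariant {n : ℕ} (P : (Fin n → Fin 2 → K) → K) : Prop :=
  ∀ (g : SL(2, K)) u, P (fun v => g.1.mulVec (u v)) = P u

theorem IsSLInvariant.mul {n : ℕ} {P Q : (Fin n → Fin 2 → K) → K} (hP : IsSLInvariant P)
    (hQ : IsSLInvariant Q) : IsSLInvariant (P * Q) := fun g u => by
  rw [Pi.mul_apply, Pi.mul_apply, hP, hQ]

theorem IsSLInvariant.pow {n : ℕ} {P : (Fin n → Fin 2 → K) → K} (hP : IsSLInvariant P) (m : ℕ) :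
    IsSLInvariant (P ^ m) := fun g u => by
  rw [Pi.pow_apply, Pi.pow_apply, hP]

theorem isSLInvariant_bracket {n : ℕ} (i j : Fin n) :
    IsSLInvariant (bracket i j : (Fin n → Fin 2 → K) → K) := fun g u => by
  have h := g.2
  rw [Matrix.det_fin_two] at h
  simp only [bracket, Matrix.mulVec, dotProduct, Fin.sum_univ_two]
  linear_combination (u i 0 * u j 1 - u i 1 * u j 0) * h

/-- The multilinear form on the duals of the `V_{κ v}` given by a product of binary forms. -/
def formsProd {n : ℕ} {κ : Fin n → ℕ} (h : ∀ v, Forms K (κ v)) :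
    MultilinearMap K (fun v => Module.Dual K (Forms K (κ v))) K :=
  (MultilinearMap.mkPiAlgebra K (Fin n) K).compLinearMap fun v =>
    Module.Dual.eval K (Forms K (κ v)) (h v)

theorem formsProd_apply {n : ℕ} {κ : Fin n → ℕ} (h : ∀ v, Forms K (κ v))
    (τ : ∀ v, Module.Dual K (Forms K (κ v))) : formsProd h τ = ∏ v, τ v (h v) := by
  simp [formsProd]

variable (K) in
/-- The multilinear forms on the duals of the `V_{κ v}` that are sums of products of binary
forms. -/
def contractions {n : ℕ} (κ : Fin n → ℕ) :
    Submodule K (MultilinearMap K (fun v => Module.Dual K (Forms K (κ v))) K) :=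
  Submodule.span K (Set.range formsProd)

/-- A multihomogeneous function of `n` points is the value on evaluations of a multilinear form on
the duals of the spaces of binary forms. -/
theorem exists_contraction {n : ℕ} {κ : Fin n → ℕ} {P : (Fin n → Fin 2 → K) → K}
    (hP : P ∈ multiform K κ) :
    ∃ M ∈ contractions K κ, ∀ u : Fin n → Fin 2 → K, M (fun v => evalAt (κ v) (u v)) = P u := by
  unfold multiform at hP
  induction hP using Submodule.span_induction with
  | mem P hP =>
    obtain ⟨h, hh, rfl⟩ := hP
    refine ⟨formsProd fun v => ⟨h v, hh v⟩, Submodule.subset_span ⟨_, rfl⟩, fun u => ?_⟩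
    rw [formsProd_apply]
    rfl
  | zero => exact ⟨0, zero_mem _, fun u => rfl⟩
  | add P Q _ _ hP hQ =>
    obtain ⟨M, hM, h⟩ := hP
    obtain ⟨N, hN, h'⟩ := hQ
    exact ⟨M + N, add_mem hM hN, fun u => by simp [h, h']⟩
  | smul c P _ hP =>
    obtain ⟨M, hM, h⟩ := hP
    exact ⟨c • M, Submodule.smul_mem _ c hM, fun u => by simp [h]⟩

/-- Since the evaluations span the dual spaces, invariance on tuples of points carries over to the
multilinear form. -/
theorem contraction_invariant [Infinite K] {n : ℕ} {κ : Fin n → ℕ}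
    {P : (Fin n → Fin 2 → K) → K} (hP : IsSLInvariant P)
    {M : MultilinearMap K (fun v => Module.Dual K (Forms K (κ v))) K}
    (hM : ∀ u : Fin n → Fin 2 → K, M (fun v => evalAt (κ v) (u v)) = P u) (g : SL(2, K))
    (τ : ∀ v, Module.Dual K (Forms K (κ v))) :
    M (fun v => τ v ∘ₗ binaryForms K (κ v) g) = M τ := by
  let b := fun v => Module.Basis.ofSpan (span_range_evalAt (K := K) (κ v)).ge
  have h : M.compLinearMap (fun v => (binaryForms K (κ v) g).dualMap) = M := by
    refine Module.Basis.ext_multilinear b fun r => ?_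
    have hr : ∀ v, ∃ u, evalAt (κ v) u = b v (r v) := fun v =>
      Module.Basis.ofSpan_subset (span_range_evalAt (K := K) (κ v)).ge ⟨r v, rfl⟩
    choose u hu using hr
    simp only [← hu]
    rw [MultilinearMap.compLinearMap_apply, hM]
    have : ∀ v, (binaryForms K (κ v) g).dualMap (evalAt (κ v) (u v)) =
        evalAt (κ v) ((g⁻¹).1.mulVec (u v)) := fun v => evalAt_comp (κ v) (u v) g
    simp only [this]
    rw [hM, hP]
  exact congrArg (fun N => N τ) h

end Symbolic

section Contraction

variable {K : Type*} [Field K] {d : ℕ}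

/-- A vector of `KX_d` as a linear polynomial function on the dual space. -/
def linPoly (w : Fin d →₀ K) : MvPolynomial (Fin d) K :=
  ∑ j, MvPolynomial.C (w j) * MvPolynomial.X j

theorem dual_apply_eq_sum (τ : Module.Dual K (Fin d →₀ K)) (w : Fin d →₀ K) :
    τ w = ∑ j, w j * τ (Finsupp.single j 1) := by
  conv_lhs => rw [← Finsupp.univ_sum_single w]
  rw [map_sum]
  refine Finset.sum_congr rfl fun j _ => ?_
  rw [← smul_eq_mul, ← map_smul, Finsupp.smul_single, smul_eq_mul, mul_one]

@[simp] theorem ev_linPoly (τ : Module.Dual K (Fin d →₀ K)) (w : Fin d →₀ K) :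
    ev τ (linPoly w) = τ w := by
  simp [linPoly, dual_apply_eq_sum τ w]

theorem exists_ev_eq {n : ℕ} {κ : Fin n → ℕ}
    {M : MultilinearMap K (fun v => Module.Dual K (Forms K (κ v))) K}
    (hM : M ∈ contractions K κ) (ι : ∀ v, Forms K (κ v) →ₗ[K] (Fin d →₀ K)) :
    ∃ p, ∀ τ, ev τ p = M fun v => τ ∘ₗ ι v := by
  unfold contractions at hM
  induction hM using Submodule.span_induction with
  | mem M hM =>
    obtain ⟨h, rfl⟩ := hM
    exact ⟨∏ v, linPoly (ι v (h v)), fun τ => by simp [formsProd_apply]⟩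
  | zero => exact ⟨0, fun τ => by simp⟩
  | add M N _ _ hM hN =>
    obtain ⟨p, hp⟩ := hM
    obtain ⟨q, hq⟩ := hN
    exact ⟨p + q, fun τ => by simp [hp, hq]⟩
  | smul c M _ hM =>
    obtain ⟨p, hp⟩ := hM
    exact ⟨c • p, fun τ => by simp [hp]⟩

theorem exists_fieldEv_eq {n k : ℕ}
    {M : MultilinearMap K (fun _ : Fin (n + 1) => Module.Dual K (Forms K k)) K}
    (hM : M ∈ contractions K fun _ => k) (ι : Forms K k →ₗ[K] (Fin d →₀ K)) :
    ∃ q, ∀ σ τ, fieldEv σ τ q = M (Fin.cons (σ ∘ₗ ι) fun _ => τ ∘ₗ ι) := by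
  unfold contractions at hM
  induction hM using Submodule.span_induction with
  | mem M hM =>
    obtain ⟨h, rfl⟩ := hM
    refine ⟨fun j => MvPolynomial.C (ι (h 0) j) * ∏ v : Fin n, linPoly (ι (h v.succ)),
      fun σ τ => ?_⟩
    simp only [fieldEv, map_mul, ev_C, map_prod, ev_linPoly, formsProd_apply, Fin.prod_univ_succ,
      Fin.cons_zero, Fin.cons_succ, LinearMap.comp_apply]
    rw [dual_apply_eq_sum σ, Finset.sum_mul]
    exact Finset.sum_congr rfl fun j _ => by ring
  | zero => exact ⟨0, fun σ τ => by simp [fieldEv]⟩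
  | add M N _ _ hM hN =>
    obtain ⟨p, hp⟩ := hM
    obtain ⟨q, hq⟩ := hN
    exact ⟨p + q, fun σ τ => by rw [fieldEv_add_right, hp, hq]; rfl⟩
  | smul c M _ hM =>
    obtain ⟨p, hp⟩ := hM
    refine ⟨c • p, fun σ τ => ?_⟩
    rw [smul_apply, ← hp]
    simp only [fieldEv, Pi.smul_apply, map_smul, smul_eq_mul, Finset.mul_sum]
    exact Finset.sum_congr rfl fun j _ => by ring

theorem exists_phi_eq_contraction {k : ℕ}
    {M : MultilinearMap K (fun _ : Fin 2 => Module.Dual K (Forms K k)) K}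
    (hM : M ∈ contractions K fun _ => k) (ι : Forms K k →ₗ[K] (Fin d →₀ K)) :
    ∃ z : FreeMetabelian K d, ∀ σ τ, phi σ τ z =
      Aff.of 0 (M ![τ ∘ₗ ι, σ ∘ₗ ι] - M ![σ ∘ₗ ι, τ ∘ₗ ι]) := by
  unfold contractions at hM
  induction hM using Submodule.span_induction with
  | mem M hM =>
    obtain ⟨h, rfl⟩ := hM
    refine ⟨⁅lin (ι (h 0)), lin (ι (h 1))⁆, fun σ τ => ?_⟩
    rw [LieHom.map_lie, phi_lin, phi_lin]
    ext
    · simp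
    · simp [formsProd_apply]
      ring
  | zero => exact ⟨0, fun σ τ => by rw [map_zero]; ext <;> simp⟩
  | add M N _ _ hM hN =>
    obtain ⟨p, hp⟩ := hM
    obtain ⟨q, hq⟩ := hN
    refine ⟨p + q, fun σ τ => ?_⟩
    rw [map_add, hp, hq]
    ext
    · simp
    · simp
      ring
  | smul c M _ hM =>
    obtain ⟨p, hp⟩ := hM
    refine ⟨c • p, fun σ τ => ?_⟩
    rw [map_smul, hp]
    ext
    · simp
    · simp
      ring

end Contraction

/-! ### Decompositions into spaces of binary forms -/

section Frame

variable {K : Type*} [Field K] {d : ℕ}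

/-- A decomposition of the `SL₂(K)`-module `KX_d` into the direct sum of the spaces of binary
forms of degrees `k i`, given by its inclusions and projections. -/
structure Frame (ρ : Representation K SL(2, K) (Fin d →₀ K)) {r : ℕ} (k : Fin r → ℕ) where
  /-- The inclusion of the `i`-th summand. -/
  inc : ∀ i, Forms K (k i) →ₗ[K] (Fin d →₀ K)
  /-- The projection to the `i`-th summand. -/
  proj : ∀ i, (Fin d →₀ K) →ₗ[K] Forms K (k i)
  map_inc : ∀ g i, ρ g ∘ₗ inc i = inc i ∘ₗ binaryForms K (k i) g
  proj_map : ∀ g i, proj i ∘ₗ ρ g = binaryForms K (k i) g ∘ₗ proj i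
  proj_inc : ∀ i, proj i ∘ₗ inc i = LinearMap.id
  proj_inc_of_ne : ∀ i j, i ≠ j → proj i ∘ₗ inc j = 0
  sum_inc_proj : ∀ w, ∑ i, inc i (proj i w) = w

/-- An isomorphism with a sum of spaces of binary forms gives a decomposition. -/
def Frame.ofEquiv {ρ : Representation K SL(2, K) (Fin d →₀ K)} {r : ℕ} {k : Fin r → ℕ}
    (e : ρ.Equiv (sumOfBinaryForms K k)) : Frame ρ k where
  inc i := e.symm.toLinearMap ∘ₗ DirectSum.lof K (Fin r) (fun i => Forms K (k i)) i
  proj i := DirectSum.component K (Fin r) (fun i => Forms K (k i)) i ∘ₗ e.toLinearMap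
  map_inc g i := by
    rw [← LinearMap.comp_assoc, ← e.symm.isIntertwining' g]
    ext1 h
    exact congrArg e.symm.toLinearMap (DirectSum.lmap_lof
      (fun i => binaryForms K (k i) g) i h)
  proj_map g i := by
    rw [LinearMap.comp_assoc, e.isIntertwining' g]
    rfl
  proj_inc i := by
    ext1 h
    change DirectSum.component K (Fin r) (fun i => Forms K (k i)) i
      (e (e.symm (DirectSum.lof K (Fin r) (fun i => Forms K (k i)) i h))) = h
    rw [Representation.Equiv.apply_symm_apply, DirectSum.component.lof_self]
  proj_inc_of_ne i j hij := by
    ext1 h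
    change DirectSum.component K (Fin r) (fun i => Forms K (k i)) i
      (e (e.symm (DirectSum.lof K (Fin r) (fun i => Forms K (k i)) j h))) = 0
    rw [Representation.Equiv.apply_symm_apply, DirectSum.component.of, dif_neg hij.symm]
  sum_inc_proj w := by
    change ∑ i, e.symm (DirectSum.lof K (Fin r) (fun i => Forms K (k i)) i (e w i)) = w
    rw [← map_sum]
    have : ∑ i, DirectSum.lof K (Fin r) (fun i => Forms K (k i)) i (e w i) = e w := by
      exact DirectSum.sum_univ_of (e w)
    rw [this, Representation.Equiv.symm_apply_apply]

/-- There are no nonzero invariant binary forms of positive degree. -/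
theorem form_eq_zero_of_invariant [CharZero K] {k : ℕ} (hk : k ≠ 0) (h : Forms K k)
    (hh : ∀ g, binaryForms K k g h = h) : h = 0 := by
  have hv : ∀ (g : SL(2, K)) v, evalAt k (g.1.mulVec v) h = evalAt k v h := by
    intro g v
    have := evalAt_comp k v g⁻¹
    rw [inv_inv] at this
    rw [← this, LinearMap.comp_apply, hh]
  have hsmul : ∀ (c : K) v, evalAt k (c • v) h = c ^ k * evalAt k v h := by
    intro c v
    rw [evalAt_apply, evalAt_apply, MvPolynomial.aeval_eq_eval, MvPolynomial.aeval_eq_eval]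
    simp only [MvPolynomial.eval_eq']
    rw [Finset.mul_sum]
    refine Finset.sum_congr rfl fun m hm => ?_
    have := h.2 (MvPolynomial.mem_support_iff.1 hm)
    simp only [Pi.smul_apply, smul_eq_mul, mul_pow, Finset.prod_mul_distrib,
      Finset.prod_pow_eq_pow_sum]
    rw [← Finsupp.degree_eq_sum, Finsupp.degree_eq_weight_one]
    rw [show (Finsupp.weight fun _ => 1) m = k from this]
    ring
  -- `v` and `2 v` are in the same orbit
  have h2 : ∀ v : Fin 2 → K, ∃ g : SL(2, K), g.1.mulVec v = (2 : K) • v := by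
    intro v
    by_cases hv0 : v 0 = 0
    · refine ⟨⟨!![2⁻¹, 0; 0, 2], by simp [Matrix.det_fin_two]⟩, ?_⟩
      ext i
      fin_cases i <;> simp [Matrix.mulVec, dotProduct, Fin.sum_univ_two, hv0]
    · refine ⟨⟨!![2, 0; 3 / 2 * v 1 / v 0, 2⁻¹], by simp [Matrix.det_fin_two]⟩, ?_⟩
      ext i
      fin_cases i
      · simp [Matrix.mulVec, dotProduct, Fin.sum_univ_two]
      · simp [Matrix.mulVec, dotProduct, Fin.sum_univ_two]
        field_simp
        ring
  refine Subtype.ext (MvPolynomial.funext fun v => ?_)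
  have : evalAt k v h = 0 := by
    obtain ⟨g, hg⟩ := h2 v
    have h1 := hv g v
    rw [hg, hsmul] at h1
    have h3 : ((2 : K) ^ k - 1) * evalAt k v h = 0 := by
      rw [sub_mul, h1, one_mul, sub_self]
    refine (mul_eq_zero.1 h3).resolve_left fun h4 => ?_
    rw [sub_eq_zero] at h4
    exact (Nat.one_lt_two_pow hk).ne' (by exact_mod_cast h4)
  rw [evalAt_apply, MvPolynomial.aeval_eq_eval] at this
  simpa using this

namespace Frame

variable {ρ : Representation K SL(2, K) (Fin d →₀ K)} {r : ℕ} {k : Fin r → ℕ} (F : Frame ρ k)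

theorem proj_inc_apply (i : Fin r) (h : Forms K (k i)) : F.proj i (F.inc i h) = h :=
  LinearMap.congr_fun (F.proj_inc i) h

theorem proj_inc_apply_of_ne {i j : Fin r} (hij : i ≠ j) (h : Forms K (k j)) :
    F.proj i (F.inc j h) = 0 :=
  LinearMap.congr_fun (F.proj_inc_of_ne i j hij) h

theorem proj_eq_zero [CharZero K] {i : Fin r} (hi : k i ≠ 0) {w : Fin d →₀ K}
    (hw : ∀ g, ρ g w = w) : F.proj i w = 0 := by
  refine form_eq_zero_of_invariant hi _ fun g => ?_
  conv_rhs => rw [← hw g]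
  exact (LinearMap.congr_fun (F.proj_map g i) w).symm

/-- The functional on `KX_d` with prescribed restrictions to the summands. -/
def dual (t : ∀ i, Module.Dual K (Forms K (k i))) : Module.Dual K (Fin d →₀ K) :=
  ∑ i, t i ∘ₗ F.proj i

theorem dual_comp_inc (t : ∀ i, Module.Dual K (Forms K (k i))) (i : Fin r) :
    F.dual t ∘ₗ F.inc i = t i := by
  ext1 h
  simp only [dual, LinearMap.comp_apply, LinearMap.sum_apply]
  rw [Finset.sum_eq_single i, proj_inc_apply]
  · intro j _ hj
    rw [proj_inc_apply_of_ne F hj, map_zero]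
  · simp

/-- The projection of `KX_d` to the sum of the trivial summands. -/
def fixedPart : Module.End K (Fin d →₀ K) := ∑ i with k i = 0, F.inc i ∘ₗ F.proj i

/-- The projection of `KX_d` to the sum of the nontrivial summands. -/
def movedPart : Module.End K (Fin d →₀ K) := ∑ i with ¬ k i = 0, F.inc i ∘ₗ F.proj i

theorem fixedPart_add_movedPart : F.fixedPart + F.movedPart = 1 := by
  ext1 w
  rw [fixedPart, movedPart, Finset.sum_filter_add_sum_filter_not]
  ext1
  simp only [LinearMap.comp_apply, LinearMap.sum_apply]
  rw [F.sum_inc_proj]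
  rfl

theorem movedPart_eq_zero [CharZero K] {w : Fin d →₀ K} (hw : ∀ g, ρ g w = w) :
    F.movedPart w = 0 := by
  simp only [movedPart, LinearMap.comp_apply, LinearMap.sum_apply]
  refine Finset.sum_eq_zero fun i hi => ?_
  rw [F.proj_eq_zero (Finset.mem_filter.1 hi).2 hw, map_zero]

theorem fixedPart_eq_self [CharZero K] {w : Fin d →₀ K} (hw : ∀ g, ρ g w = w) :
    F.fixedPart w = w := by
  have := LinearMap.congr_fun F.fixedPart_add_movedPart w
  rwa [LinearMap.add_apply, F.movedPart_eq_zero hw, add_zero] at this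

theorem fixedPart_comp_inc {i : Fin r} (hi : k i ≠ 0) : F.fixedPart ∘ₗ F.inc i = 0 := by
  ext1 h
  simp only [fixedPart, LinearMap.comp_apply, LinearMap.sum_apply]
  refine Finset.sum_eq_zero fun j hj => ?_
  rw [proj_inc_apply_of_ne F, map_zero]
  rintro rfl
  exact hi (Finset.mem_filter.1 hj).2

theorem comp_inc (τ : Module.Dual K (Fin d →₀ K)) (g : SL(2, K)) (i : Fin r) :
    (τ ∘ₗ ρ g) ∘ₗ F.inc i = (τ ∘ₗ F.inc i) ∘ₗ binaryForms K (k i) g := by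
  rw [LinearMap.comp_assoc, F.map_inc, LinearMap.comp_assoc]

theorem not_isFinitelyGenerated [CharZero K] (p : MvPolynomial (Fin d) K)
    (hp : ∀ g τ, ev (τ ∘ₗ ρ g) p = ev τ p)
    {z : FreeMetabelian K d}
    {χ : Module.Dual K (Fin d →₀ K) → Module.Dual K (Fin d →₀ K) → K}
    (hz : ∀ σ τ, phi σ τ z = Aff.of 0 (χ σ τ))
    (hχ : ∀ g σ τ, χ (σ ∘ₗ ρ g) (τ ∘ₗ ρ g) = χ σ τ) (σ τ : Module.Dual K (Fin d →₀ K))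
    (hp₀ : ev (τ ∘ₗ F.fixedPart) p = 0) (hp₁ : ev τ p ≠ 0) (hχ₁ : χ σ τ ≠ 0) :
    ¬ IsFinitelyGenerated (invariants ρ) := by
  refine MetabelianInvariants.not_isFinitelyGenerated ρ F.fixedPart F.movedPart
    F.fixedPart_add_movedPart (fun w hw s => ?_) p hp ((mem_invariants_iff ρ z).2 ?_) hz σ τ
    hp₀ hp₁ hχ₁
  · rw [LinearMap.add_apply, LinearMap.smul_apply, F.movedPart_eq_zero hw, F.fixedPart_eq_self hw,
      smul_zero, add_zero]
  · intro g σ τ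
    rw [hz, hz, hχ]

/-- An invariant multihomogeneous function of points on the summands `c v` gives an invariant
polynomial. -/
theorem exists_invariant_poly [CharZero K] {n : ℕ} (c : Fin n → Fin r)
    {P : (Fin n → Fin 2 → K) → K} (hP : P ∈ multiform K fun v => k (c v))
    (hPi : IsSLInvariant P) :
    ∃ M : MultilinearMap K (fun v => Module.Dual K (Forms K (k (c v)))) K,
      (∀ u : Fin n → Fin 2 → K, M (fun v => evalAt (k (c v)) (u v)) = P u) ∧
      ∃ p, (∀ τ, ev τ p = M fun v => τ ∘ₗ F.inc (c v)) ∧ ∀ g τ, ev (τ ∘ₗ ρ g) p = ev τ p := by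
  obtain ⟨M, hM, h⟩ := exists_contraction hP
  obtain ⟨p, hp⟩ := exists_ev_eq hM fun v => F.inc (c v)
  refine ⟨M, h, p, hp, fun g τ => ?_⟩
  rw [hp, hp]
  simp only [F.comp_inc]
  exact contraction_invariant hPi h g _

/-- An invariant multihomogeneous function of points on one summand gives an invariant covector
field. -/
theorem exists_invariant_field [CharZero K] {n : ℕ} (i : Fin r)
    {P : (Fin (n + 1) → Fin 2 → K) → K} (hP : P ∈ multiform K fun _ => k i)
    (hPi : IsSLInvariant P) :
    ∃ M : MultilinearMap K (fun _ : Fin (n + 1) => Module.Dual K (Forms K (k i))) K,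
      (∀ u : Fin (n + 1) → Fin 2 → K, M (fun v => evalAt (k i) (u v)) = P u) ∧
      ∃ q, (∀ σ τ, fieldEv σ τ q = M (Fin.cons (σ ∘ₗ F.inc i) fun _ => τ ∘ₗ F.inc i)) ∧
        ∀ g σ τ, fieldEv (σ ∘ₗ ρ g) (τ ∘ₗ ρ g) q = fieldEv σ τ q := by
  obtain ⟨M, hM, h⟩ := exists_contraction hP
  obtain ⟨q, hq⟩ := exists_fieldEv_eq hM (F.inc i)
  refine ⟨M, h, q, hq, fun g σ τ => ?_⟩
  rw [hq, hq]
  simp only [F.comp_inc]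
  rw [← contraction_invariant hPi h g (Fin.cons (σ ∘ₗ F.inc i) fun _ => τ ∘ₗ F.inc i)]
  congr 1
  funext v
  refine Fin.cases ?_ (fun v => ?_) v <;> simp

/-- An invariant bihomogeneous function on one summand gives an invariant element of the derived
ideal. -/
theorem exists_invariant_comm [CharZero K] (i : Fin r)
    {P : (Fin 2 → Fin 2 → K) → K} (hP : P ∈ multiform K fun _ => k i)
    (hPi : IsSLInvariant P) :
    ∃ M : MultilinearMap K (fun _ : Fin 2 => Module.Dual K (Forms K (k i))) K,
      (∀ u : Fin 2 → Fin 2 → K, M (fun v => evalAt (k i) (u v)) = P u) ∧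
      ∃ z : FreeMetabelian K d,
        ∃ χ : Module.Dual K (Fin d →₀ K) → Module.Dual K (Fin d →₀ K) → K,
        (∀ σ τ, phi σ τ z = Aff.of 0 (χ σ τ)) ∧
        (∀ σ τ, χ σ τ = M ![τ ∘ₗ F.inc i, σ ∘ₗ F.inc i] - M ![σ ∘ₗ F.inc i, τ ∘ₗ F.inc i]) ∧
        ∀ g σ τ, χ (σ ∘ₗ ρ g) (τ ∘ₗ ρ g) = χ σ τ := by
  obtain ⟨M, hM, h⟩ := exists_contraction hP
  obtain ⟨z, hz⟩ := exists_phi_eq_contraction hM (F.inc i)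
  refine ⟨M, h, z, _, hz, fun _ _ => rfl, fun g σ τ => ?_⟩
  have key : ∀ a b, M ![a ∘ₗ binaryForms K (k i) g, b ∘ₗ binaryForms K (k i) g] = M ![a, b] := by
    intro a b
    rw [← contraction_invariant hPi h g ![a, b]]
    congr 1
    funext v
    fin_cases v <;> rfl
  simp only [F.comp_inc, key]

end Frame

end Frame

/-! ### The representations with infinitely generated invariants -/

section Infinite

variable {K : Type*} [Field K] {d : ℕ}

theorem contraction_sum {n m : ℕ} {κ : Fin n → ℕ} {P : (Fin n → Fin 2 → K) → K}
    {M : MultilinearMap K (fun v => Module.Dual K (Forms K (κ v))) K}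
    (hM : ∀ u : Fin n → Fin 2 → K, M (fun v => evalAt (κ v) (u v)) = P u)
    (u : Fin m → Fin 2 → K) :
    M (fun v => ∑ j, evalAt (κ v) (u j)) = ∑ s : Fin n → Fin m, P fun v => u (s v) := by
  rw [M.map_sum]
  exact Finset.sum_congr rfl fun s _ => hM fun v => u (s v)

theorem contraction_cons_sum {n m k : ℕ} {P : (Fin (n + 1) → Fin 2 → K) → K}
    {M : MultilinearMap K (fun _ : Fin (n + 1) => Module.Dual K (Forms K k)) K}
    (hM : ∀ u : Fin (n + 1) → Fin 2 → K, M (fun v => evalAt k (u v)) = P u)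
    (u₀ : Fin 2 → K) (u : Fin m → Fin 2 → K) :
    M (Fin.cons (evalAt k u₀) fun _ => ∑ j, evalAt k (u j)) =
      ∑ s : Fin n → Fin m, P (Fin.cons u₀ fun v => u (s v)) := by
  have h := (M.curryLeft (evalAt k u₀)).map_sum fun (_ : Fin n) j => evalAt k (u j)
  rw [MultilinearMap.curryLeft_apply] at h
  rw [h]
  refine Finset.sum_congr rfl fun s _ => ?_
  rw [MultilinearMap.curryLeft_apply, ← hM]
  congr 1
  funext v
  refine Fin.cases ?_ (fun v => ?_) v <;> simp

theorem contraction_cons_const {n m k : ℕ} {P : (Fin (n + 1) → Fin 2 → K) → K}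
    {M : MultilinearMap K (fun _ : Fin (n + 1) => Module.Dual K (Forms K k)) K}
    (hM : ∀ u : Fin (n + 1) → Fin 2 → K, M (fun v => evalAt k (u v)) = P u)
    (u : Fin m → Fin 2 → K) :
    M (Fin.cons (∑ j, evalAt k (u j)) fun _ => ∑ j, evalAt k (u j)) =
      ∑ s : Fin (n + 1) → Fin m, P fun v => u (s v) := by
  rw [← contraction_sum hM]
  congr 1
  funext v
  refine Fin.cases ?_ (fun v => ?_) v <;> simp

/-- The standard basis of the plane. -/
def stdPt : Fin 2 → Fin 2 → K := ![![1, 0], ![0, 1]]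

theorem edge_mem_multiform (k : ℕ) :
    (bracket 0 1 ^ k : (Fin 2 → Fin 2 → K) → K) ∈ multiform K fun _ => k := by
  have h := bracket_pow_mem_multiform (K := K) (0 : Fin 2) 1 k
  convert h using 2
  funext v
  fin_cases v <;> simp

theorem cycle_mem_multiform {k : ℕ} (hk : 1 ≤ k) :
    (bracket 0 1 * bracket 1 2 ^ (k - 1) * bracket 2 3 * bracket 3 0 ^ (k - 1) :
      (Fin 4 → Fin 2 → K) → K) ∈ multiform K fun _ => k := by
  have h := mul_mem_multiform (mul_mem_multiform (mul_mem_multiform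
    (bracket_mem_multiform (K := K) (0 : Fin 4) 1) (bracket_pow_mem_multiform 1 2 (k - 1)))
    (bracket_mem_multiform 2 3)) (bracket_pow_mem_multiform 3 0 (k - 1))
  convert h using 2
  funext v
  fin_cases v <;> simp <;> omega

theorem sum_edge {k : ℕ} (hk : Even k) :
    ∑ s : Fin 2 → Fin 2, (bracket 0 1 ^ k : (Fin 2 → Fin 2 → K) → K) (fun v => stdPt (s v)) =
      if k = 0 then 4 else 2 := by
  have hu : (Finset.univ : Finset (Fin 2 → Fin 2)) = {![0, 0], ![0, 1], ![1, 0], ![1, 1]} := by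
    decide
  rw [hu, Finset.sum_insert (by decide), Finset.sum_insert (by decide),
    Finset.sum_insert (by decide), Finset.sum_singleton]
  simp only [Pi.pow_apply, bracket, stdPt]
  by_cases h : k = 0
  · subst h
    norm_num
  · simp [h, hk.neg_one_pow]
    norm_num

/-- The closed walks of length four on an edge are the two alternating ones. -/
theorem sum_cycle {k : ℕ} (hk : 2 ≤ k) :
    ∑ s : Fin 4 → Fin 2, (bracket 0 1 * bracket 1 2 ^ (k - 1) * bracket 2 3 *
      bracket 3 0 ^ (k - 1) : (Fin 4 → Fin 2 → K) → K) (fun v => stdPt (s v)) = 2 := by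
  have h1 : k - 1 ≠ 0 := by omega
  rw [Fintype.sum_eq_add ![0, 1, 0, 1] ![1, 0, 1, 0] (by decide)]
  · simp only [Pi.mul_apply, Pi.pow_apply, bracket, stdPt]
    simp
    rw [← mul_pow]
    norm_num
  · intro s hs
    have hb : ∀ i j : Fin 4, s i = s j →
        bracket i j (fun v => stdPt (s v) : Fin 4 → Fin 2 → K) = 0 := by
      intro i j hij
      simp only [bracket, hij]
      ring
    have hs' : s 0 = s 1 ∨ s 1 = s 2 ∨ s 2 = s 3 ∨ s 3 = s 0 := by
      clear hb
      revert s
      decide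
    simp only [Pi.mul_apply, Pi.pow_apply]
    rcases hs' with h | h | h | h <;> simp [hb _ _ h, h1]

namespace Frame

variable {ρ : Representation K SL(2, K) (Fin d →₀ K)} {r : ℕ} {k : Fin r → ℕ}

theorem map_zero_of_pos (F : Frame ρ k) {n : ℕ} (c : Fin (n + 1) → Fin r) (hc : k (c 0) ≠ 0)
    (M : MultilinearMap K (fun v => Module.Dual K (Forms K (k (c v)))) K)
    (τ : Module.Dual K (Fin d →₀ K)) :
    M (fun v => (τ ∘ₗ F.fixedPart) ∘ₗ F.inc (c v)) = 0 := by
  refine M.map_coord_zero 0 ?_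
  rw [LinearMap.comp_assoc, F.fixedPart_comp_inc hc, LinearMap.comp_zero]

/-- The commutator given by the invariant symplectic form on a summand of odd degree can be
multiplied by the powers of an invariant polynomial of degree four on a summand of degree at
least two. -/
theorem not_fg_of_odd_of_two_le [CharZero K] (F : Frame ρ k) {i j : Fin r} (hi : Odd (k i))
    (hj : 2 ≤ k j) :
    ¬ IsFinitelyGenerated (invariants ρ) := by
  obtain ⟨M, hM, z, χ, hz, hχM, hχ⟩ := F.exists_invariant_comm i (edge_mem_multiform (k i))
    ((isSLInvariant_bracket 0 1).pow _)
  obtain ⟨N, hN, p, hpN, hp⟩ := F.exists_invariant_poly (fun _ : Fin 4 => j)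
    (cycle_mem_multiform (by omega)) ((((isSLInvariant_bracket 0 1).mul
      ((isSLInvariant_bracket 1 2).pow _)).mul (isSLInvariant_bracket 2 3)).mul
        ((isSLInvariant_bracket 3 0).pow _))
  refine F.not_isFinitelyGenerated p hp hz hχ (F.dual fun i => evalAt (k i) (stdPt 1))
    (F.dual fun i => ∑ l, evalAt (k i) (stdPt l)) ?_ ?_ ?_
  · rw [hpN]
    exact F.map_zero_of_pos (fun _ => j) (by omega) N _
  · rw [hpN]
    simp only [F.dual_comp_inc]
    rw [contraction_sum hN, sum_cycle hj]
    exact two_ne_zero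
  · have hk0 : k i ≠ 0 := hi.pos.ne'
    have h₁ : ∀ a b c : Module.Dual K (Forms K (k i)), M ![a + b, c] = M ![a, c] + M ![b, c] := by
      intro a b c
      exact MultilinearMap.cons_add M ![c] a b
    have h₂ : ∀ a b c : Module.Dual K (Forms K (k i)), M ![c, a + b] = M ![c, a] + M ![c, b] := by
      intro a b c
      have hup : ∀ x, Function.update ![c, 0] 1 x = ![c, x] := by
        intro x
        funext v
        fin_cases v <;> simp
      have := M.map_update_add ![c, 0] 1 a b
      rwa [hup, hup, hup] at this
    have hM' : ∀ a b : Fin 2 → K, M ![evalAt (k i) a, evalAt (k i) b] =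
        (a 0 * b 1 - a 1 * b 0) ^ k i := by
      intro a b
      rw [show (a 0 * b 1 - a 1 * b 0) ^ k i = (bracket 0 1 ^ k i : (Fin 2 → Fin 2 → K) → K)
        ![a, b] from rfl, ← hM]
      congr 1
      funext v
      fin_cases v <;> rfl
    rw [hχM, F.dual_comp_inc, F.dual_comp_inc, Fin.sum_univ_two, h₁, h₂]
    simp only [hM', stdPt]
    simp [hk0, hi.neg_one_pow]

/-- The determinant of two points of the plane is an invariant polynomial on `V_1 ⊕ V_1`. -/
theorem not_fg_of_one_of_one [CharZero K] (F : Frame ρ k) {i j : Fin r} (hij : i ≠ j)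
    (hi : k i = 1) (hj : k j = 1) :
    ¬ IsFinitelyGenerated (invariants ρ) := by
  obtain ⟨M, hM, z, χ, hz, hχM, hχ⟩ := F.exists_invariant_comm i (edge_mem_multiform (k i))
    ((isSLInvariant_bracket 0 1).pow _)
  have hP : (bracket 0 1 : (Fin 2 → Fin 2 → K) → K) ∈
      multiform K fun v => k ((![i, j] : Fin 2 → Fin r) v) := by
    have h := bracket_mem_multiform (K := K) (0 : Fin 2) 1
    convert h using 2
    funext v
    fin_cases v <;> simp [hi, hj]
  obtain ⟨N, hN, p, hpN, hp⟩ := F.exists_invariant_poly ![i, j] hP (isSLInvariant_bracket 0 1)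
  refine F.not_isFinitelyGenerated p hp hz hχ (F.dual fun i => evalAt (k i) (stdPt 1))
    (F.dual fun l => evalAt (k l) (stdPt (if l = i then 0 else 1))) ?_ ?_ ?_
  · rw [hpN]
    exact F.map_zero_of_pos ![i, j] (by simp [hi]) N _
  · rw [hpN]
    simp only [F.dual_comp_inc]
    rw [hN fun v => stdPt (if (![i, j] : Fin 2 → Fin r) v = i then 0 else 1)]
    simp [bracket, stdPt, hij.symm]
  · have hM' : ∀ a b : Fin 2 → K, M ![evalAt (k i) a, evalAt (k i) b] =
        (a 0 * b 1 - a 1 * b 0) ^ k i := by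
      intro a b
      rw [show (a 0 * b 1 - a 1 * b 0) ^ k i = (bracket 0 1 ^ k i : (Fin 2 → Fin 2 → K) → K)
        ![a, b] from rfl, ← hM]
      congr 1
      funext v
      fin_cases v <;> rfl
    rw [hχM, F.dual_comp_inc, F.dual_comp_inc]
    simp only [hM', stdPt]
    simp [hi]

/-- On a summand of even degree, an invariant covector field which at some point `τ` is not
proportional to the gradient of the quadratic invariant gives infinite generation: the two fields
have a nonzero Koszul commutator, and the quadratic invariant is the polynomial multiplying it.
The alternatives in `h` are the two situations in which non-proportionality is visible on the
covector `σ`. -/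
theorem not_fg_of_field [CharZero K] (F : Frame ρ k) {i : Fin r} (hi₀ : k i ≠ 0)
    {q : Fin d → MvPolynomial (Fin d) K}
    (hq : ∀ g σ τ, fieldEv (σ ∘ₗ ρ g) (τ ∘ₗ ρ g) q = fieldEv σ τ q)
    (σ τ : Module.Dual K (Fin d →₀ K)) {m : ℕ} (u : Fin m → Fin 2 → K)
    (hτ : τ ∘ₗ F.inc i = ∑ j, evalAt (k i) (u j))
    (hu : ∑ s : Fin 2 → Fin m, (bracket 0 1 ^ k i : (Fin 2 → Fin 2 → K) → K)
      (fun v => u (s v)) ≠ 0)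
    (h : (fieldEv τ τ q = 0 ∧ fieldEv σ τ q ≠ 0) ∨
      (fieldEv τ τ q ≠ 0 ∧ fieldEv σ τ q = 0 ∧ σ ∘ₗ F.inc i = τ ∘ₗ F.inc i)) :
    ¬ IsFinitelyGenerated (invariants ρ) := by
  obtain ⟨N, hN, p, hpN, hp⟩ := F.exists_invariant_poly (fun _ : Fin 2 => i)
    (edge_mem_multiform (k i)) ((isSLInvariant_bracket 0 1).pow _)
  obtain ⟨M, hM, q', hqM, hq'⟩ := F.exists_invariant_field (n := 1) i (edge_mem_multiform (k i))
    ((isSLInvariant_bracket 0 1).pow _)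
  obtain ⟨z, hz⟩ := exists_koszul q q'
  have hττ : fieldEv τ τ q' ≠ 0 := by
    rw [hqM, hτ, contraction_cons_const hM]
    exact hu
  refine F.not_isFinitelyGenerated p hp hz (fun g σ τ => by rw [hq, hq, hq', hq']) σ τ ?_ ?_ ?_
  · rw [hpN]
    exact F.map_zero_of_pos (fun _ => i) hi₀ N _
  · rw [hpN, hτ, contraction_sum hN]
    exact hu
  · rcases h with ⟨h₁, h₂⟩ | ⟨h₁, h₂, h₃⟩
    · rw [h₁, zero_mul, zero_sub]
      exact neg_ne_zero.2 (mul_ne_zero h₂ hττ)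
    · rw [h₂, zero_mul, sub_zero, hqM, h₃, ← hqM]
      exact mul_ne_zero h₁ hττ

/-- The gradients of the invariant quadratic forms on two summands of even degree are not
proportional. The second summand may be trivial. -/
theorem not_fg_of_even_of_even [CharZero K] (F : Frame ρ k) {i j : Fin r} (hij : i ≠ j)
    (hi : Even (k i)) (hi₀ : k i ≠ 0) (hj : Even (k j)) : ¬ IsFinitelyGenerated (invariants ρ) := by
  obtain ⟨M, hM, q, hqM, hq⟩ := F.exists_invariant_field (n := 1) j (edge_mem_multiform (k j))
    ((isSLInvariant_bracket 0 1).pow _)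
  refine F.not_fg_of_field hi₀ hq
    (F.dual fun l => if l = i then ∑ a, evalAt (k l) (stdPt a) else 0)
    (F.dual fun l => ∑ a, evalAt (k l) (stdPt a)) stdPt (F.dual_comp_inc _ _) ?_
    (Or.inr ⟨?_, ?_, ?_⟩)
  · rw [sum_edge hi, if_neg hi₀]
    exact two_ne_zero
  · rw [hqM, F.dual_comp_inc, contraction_cons_const hM, sum_edge hj]
    split_ifs <;> norm_num
  · rw [hqM, F.dual_comp_inc]
    exact M.map_coord_zero 0 (by simp [hij.symm])
  · simp [F.dual_comp_inc]

/-- At the sum of the evaluations at the two standard basis vectors, the cubic invariant of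
binary quartics vanishes, but its gradient does not. -/
theorem not_fg_of_four [CharZero K] (F : Frame ρ k) {i : Fin r} (hi : k i = 4) :
    ¬ IsFinitelyGenerated (invariants ρ) := by
  have hP : (bracket 0 1 ^ 2 * bracket 1 2 ^ 2 * bracket 2 0 ^ 2 : (Fin 3 → Fin 2 → K) → K) ∈
      multiform K fun _ => k i := by
    have h := mul_mem_multiform (mul_mem_multiform
      (bracket_pow_mem_multiform (K := K) (0 : Fin 3) 1 2) (bracket_pow_mem_multiform 1 2 2))
      (bracket_pow_mem_multiform 2 0 2)
    convert h using 2
    funext v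
    fin_cases v <;> simp [hi]
  obtain ⟨M, hM, q, hqM, hq⟩ := F.exists_invariant_field (n := 2) i hP
    ((((isSLInvariant_bracket 0 1).pow _).mul ((isSLInvariant_bracket 1 2).pow _)).mul
      ((isSLInvariant_bracket 2 0).pow _))
  refine F.not_fg_of_field (i := i) (by omega) hq
    (F.dual fun l => evalAt (k l) ![1, 1])
    (F.dual fun l => ∑ a, evalAt (k l) (stdPt a)) stdPt (F.dual_comp_inc _ _) ?_
    (Or.inl ⟨?_, ?_⟩)
  · rw [sum_edge (by rw [hi]; decide), if_neg (by omega)]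
    exact two_ne_zero
  · rw [hqM, F.dual_comp_inc, contraction_cons_const hM]
    refine Finset.sum_eq_zero fun s _ => ?_
    have hs : s 0 = s 1 ∨ s 1 = s 2 ∨ s 2 = s 0 := by
      revert s
      decide
    simp only [Pi.mul_apply, Pi.pow_apply, bracket]
    rcases hs with h | h | h <;> rw [h] <;> ring
  · rw [hqM, F.dual_comp_inc, F.dual_comp_inc, contraction_cons_sum hM]
    have hP' : ∀ s : Fin 2 → Fin 2,
        (bracket 0 1 ^ 2 * bracket 1 2 ^ 2 * bracket 2 0 ^ 2 : (Fin 3 → Fin 2 → K) → K)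
        (Fin.cons ![1, 1] fun v => stdPt (s v)) =
        (1 * stdPt (s 0) 1 - 1 * stdPt (s 0) 0) ^ 2 *
        (stdPt (s 0) 0 * stdPt (s 1) 1 - stdPt (s 0) 1 * stdPt (s 1) 0) ^ 2 *
        (stdPt (s 1) 0 * 1 - stdPt (s 1) 1 * 1) ^ 2 := fun s => rfl
    refine ne_of_eq_of_ne (Finset.sum_congr rfl fun s _ => hP' s) ?_
    have hu : (Finset.univ : Finset (Fin 2 → Fin 2)) =
        {![0, 0], ![0, 1], ![1, 0], ![1, 1]} := by
      decide
    rw [hu, Finset.sum_insert (by decide), Finset.sum_insert (by decide),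
      Finset.sum_insert (by decide), Finset.sum_singleton]
    simp [stdPt]

/-- Three points of the plane. Their brackets with each other and with `(1, 0)` are nonzero
integers. -/
def testPt (l : Fin 3) : Fin 2 → K := ![-(l : ℕ), 1]

set_option maxRecDepth 4000 in
/-- For even `k ≥ 6` there is an invariant covector field of degree three which vanishes on the
diagonal, but not identically, at a sum of three evaluations: each term of its value on the
diagonal involves four of the three points, hence two equal ones. -/
theorem not_fg_of_six_le [CharZero K] (F : Frame ρ k) {i : Fin r} (hi : Even (k i))
    (hi₆ : 6 ≤ k i) : ¬ IsFinitelyGenerated (invariants ρ) := by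
  obtain ⟨m, hm⟩ : ∃ m, k i = m + 2 := ⟨k i - 2, by omega⟩
  have hm_even : Even m := by
    have := hi
    rw [hm] at this
    exact (Nat.even_add.1 this).2 even_two
  have hP : (bracket 0 1 ^ m * bracket 2 3 ^ m * bracket 0 2 * bracket 1 3 * bracket 0 3 *
      bracket 1 2 : (Fin 4 → Fin 2 → K) → K) ∈ multiform K fun _ => k i := by
    have h := mul_mem_multiform (mul_mem_multiform (mul_mem_multiform (mul_mem_multiform
      (mul_mem_multiform (bracket_pow_mem_multiform (K := K) (0 : Fin 4) 1 m)
      (bracket_pow_mem_multiform 2 3 m)) (bracket_mem_multiform 0 2)) (bracket_mem_multiform 1 3))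
      (bracket_mem_multiform 0 3)) (bracket_mem_multiform 1 2)
    convert h using 2
    funext v
    fin_cases v <;> simp [hm]
  obtain ⟨M, hM, q, hqM, hq⟩ := F.exists_invariant_field (n := 3) i hP
    (((((((isSLInvariant_bracket 0 1).pow _).mul ((isSLInvariant_bracket 2 3).pow _)).mul
      (isSLInvariant_bracket 0 2)).mul (isSLInvariant_bracket 1 3)).mul
      (isSLInvariant_bracket 0 3)).mul (isSLInvariant_bracket 1 2))
  refine F.not_fg_of_field (i := i) (by omega) hq
    (F.dual fun l => evalAt (k l) ![1, 0])
    (F.dual fun l => ∑ a, evalAt (k l) (testPt a)) testPt (F.dual_comp_inc _ _) ?_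
    (Or.inl ⟨?_, ?_⟩)
  · have hu : (Finset.univ : Finset (Fin 2 → Fin 3)) =
        {![0, 0], ![0, 1], ![0, 2], ![1, 0], ![1, 1], ![1, 2], ![2, 0], ![2, 1], ![2, 2]} := by
      decide
    have hP' : ∀ s : Fin 2 → Fin 3, (bracket 0 1 ^ k i : (Fin 2 → Fin 2 → K) → K)
        (fun v => testPt (s v)) = (((s 1 : ℕ) : K) - ((s 0 : ℕ) : K)) ^ k i := by
      intro s
      simp only [Pi.pow_apply, bracket, testPt]
      simp
      ring
    refine ne_of_eq_of_ne (Finset.sum_congr rfl fun s _ => hP' s) ?_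
    rw [hu]
    repeat rw [Finset.sum_insert (by decide)]
    rw [Finset.sum_singleton]
    have h0 : k i ≠ 0 := by omega
    have h2 : ((1 : K) - 2) ^ k i = 1 := by
      rw [show (1 : K) - 2 = -1 by norm_num, hi.neg_one_pow]
    have h3 : ((2 : K) - 1) ^ k i = 1 := by
      rw [show (2 : K) - 1 = 1 by norm_num, one_pow]
    simp [h0, hi.neg_one_pow, hi.neg_pow, h2, h3]
    exact_mod_cast (by positivity : (1 + (2 ^ k i + (1 + (1 + (2 ^ k i + 1)))) : ℕ) ≠ 0)
  · rw [hqM, F.dual_comp_inc, contraction_cons_const hM]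
    refine Finset.sum_eq_zero fun s _ => ?_
    have hs : s 0 = s 1 ∨ s 2 = s 3 ∨ s 0 = s 2 ∨ s 1 = s 3 ∨ s 0 = s 3 ∨ s 1 = s 2 := by
      revert s
      decide
    have hb : ∀ i j : Fin 4, s i = s j →
        bracket i j (fun v => testPt (s v) : Fin 4 → Fin 2 → K) = 0 := by
      intro i j hij
      simp only [bracket, hij]
      ring
    have h1 : m ≠ 0 := by omega
    simp only [Pi.mul_apply, Pi.pow_apply]
    rcases hs with h | h | h | h | h | h <;> simp [hb _ _ h, h1]
  · rw [hqM, F.dual_comp_inc, F.dual_comp_inc, contraction_cons_sum hM]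
    -- only the six permutations of the three points contribute
    have hS : ∀ s ∈ (Finset.univ : Finset (Fin 3 → Fin 3)),
        s ∉ ({![0, 1, 2], ![0, 2, 1], ![1, 0, 2], ![1, 2, 0], ![2, 0, 1], ![2, 1, 0]} :
          Finset (Fin 3 → Fin 3)) → s 1 = s 2 ∨ s 0 = s 2 ∨ s 0 = s 1 := by
      decide
    have hP' : ∀ s : Fin 3 → Fin 3, (bracket 0 1 ^ m * bracket 2 3 ^ m * bracket 0 2 *
        bracket 1 3 * bracket 0 3 * bracket 1 2 : (Fin 4 → Fin 2 → K) → K)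
        (Fin.cons ![1, 0] fun v => testPt (s v)) = (((s 2 : ℕ) : K) - (s 1 : ℕ)) ^ m *
          (((s 2 : ℕ) : K) - (s 0 : ℕ)) * (((s 1 : ℕ) : K) - (s 0 : ℕ)) := by
      intro s
      have h : (bracket 0 1 ^ m * bracket 2 3 ^ m * bracket 0 2 *
        bracket 1 3 * bracket 0 3 * bracket 1 2 : (Fin 4 → Fin 2 → K) → K)
        (Fin.cons ![1, 0] fun v => testPt (s v)) =
        (1 * 1 - 0 * -((s 0 : ℕ) : K)) ^ m *
        (-((s 1 : ℕ) : K) * 1 - 1 * -((s 2 : ℕ) : K)) ^ m *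
        (1 * 1 - 0 * -((s 1 : ℕ) : K)) * (-((s 0 : ℕ) : K) * 1 - 1 * -((s 2 : ℕ) : K)) *
        (1 * 1 - 0 * -((s 2 : ℕ) : K)) * (-((s 0 : ℕ) : K) * 1 - 1 * -((s 1 : ℕ) : K)) := rfl
      rw [h]
      simp only [one_mul, zero_mul, mul_one, sub_zero, one_pow, sub_neg_eq_add, neg_add_eq_sub]
    refine ne_of_eq_of_ne (Finset.sum_congr rfl fun s _ => hP' s) ?_
    rw [← Finset.sum_subset (Finset.subset_univ
      {![0, 1, 2], ![0, 2, 1], ![1, 0, 2], ![1, 2, 0], ![2, 0, 1], ![2, 1, 0]})]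
    · repeat rw [Finset.sum_insert (by decide)]
      rw [Finset.sum_singleton]
      have h2 : ((1 : K) - 2) ^ m = 1 := by
        rw [show (1 : K) - 2 = -1 by norm_num, hm_even.neg_one_pow]
      have h3 : ((2 : K) - 1) ^ m = 1 := by
        rw [show (2 : K) - 1 = 1 by norm_num, one_pow]
      simp [hm_even.neg_one_pow, hm_even.neg_pow, h2, h3]
      intro h
      have h4 : ((2 ^ m : ℕ) : K) = (4 : ℕ) := by
        push_cast
        linear_combination (-1 / 2 : K) * h
      have h5 : 2 ^ 4 ≤ 2 ^ m := Nat.pow_le_pow_right (by norm_num) (by omega)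
      rw [Nat.cast_inj.1 h4] at h5
      omega
    · intro s hs hs'
      have h1 : m ≠ 0 := by omega
      rcases hS s hs hs' with h | h | h <;> simp [h, h1]

end Frame

end Infinite

/-! ### Invariants of binary quadratic forms -/

section Quadratic

variable {K : Type*} [Field K] {d : ℕ}

/-- The monomial `X ^ i Y ^ j` as a binary form. -/
def mono {k : ℕ} (i j : ℕ) (h : i + j = k) : Forms K k :=
  ⟨MvPolynomial.X 0 ^ i * MvPolynomial.X 1 ^ j, by
    subst h
    simpa using ((MvPolynomial.isHomogeneous_X K (0 : Fin 2)).pow i).mul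
      ((MvPolynomial.isHomogeneous_X K (1 : Fin 2)).pow j)⟩

@[simp] theorem evalAt_mono {k : ℕ} (v : Fin 2 → K) (i j : ℕ) (h : i + j = k) :
    evalAt k v (mono i j h) = v 0 ^ i * v 1 ^ j := by
  simp [evalAt_apply, mono]

/-- A functional on binary forms is determined by its values on the monomials. -/
theorem forms_ext {k : ℕ} {V : Type*} [AddCommGroup V] [Module K V] {s t : Forms K k →ₗ[K] V}
    (h : ∀ i j (hij : i + j = k), s (mono i j hij) = t (mono i j hij)) : s = t := by
  ext1 f
  have hdeg : ∀ m ∈ (f : MvPolynomial (Fin 2) K).support, m 0 + m 1 = k := by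
    intro m hm
    have := f.2 (MvPolynomial.mem_support_iff.1 hm)
    rw [← this]
    simp [Finsupp.weight_apply, Finsupp.sum_fintype]
  have hf : f = ∑ m : (f : MvPolynomial (Fin 2) K).support,
      MvPolynomial.coeff m.1 (f : MvPolynomial (Fin 2) K) •
        mono (m.1 0) (m.1 1) (hdeg m.1 m.2) := by
    refine Subtype.ext ?_
    conv_lhs => rw [MvPolynomial.as_sum (f : MvPolynomial (Fin 2) K)]
    rw [AddSubmonoidClass.coe_finsetSum, ← Finset.sum_coe_sort]
    refine Finset.sum_congr rfl fun m _ => ?_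
    rw [MvPolynomial.monomial_eq, Finsupp.prod_fintype _ _ (by simp), Fin.prod_univ_two]
    simp [mono, MvPolynomial.smul_eq_C_mul]
  rw [hf, map_sum, map_sum]
  refine Finset.sum_congr rfl fun m _ => ?_
  rw [map_smul, map_smul, h]

theorem exists_SL_mulVec (p q r s : K) (h : p * s - q * r = 1) :
    ∃ g : SL(2, K), ∀ v : Fin 2 → K,
      (g⁻¹).1.mulVec v = ![p * v 0 + q * v 1, r * v 0 + s * v 1] := by
  obtain ⟨M, hM⟩ : ∃ M : SL(2, K), M.1 = !![p, q; r, s] :=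
    ⟨⟨!![p, q; r, s], by rw [Matrix.det_fin_two_of, h]⟩, rfl⟩
  refine ⟨M⁻¹, fun v => ?_⟩
  rw [inv_inv, hM]
  ext i
  fin_cases i <;> simp [Matrix.mulVec, dotProduct, Fin.sum_univ_two]

theorem poly_eq_zero_of_ne [CharZero K] {P : Polynomial K} (h : ∀ x, x ≠ 0 → P.eval x = 0) :
    P = 0 := by
  refine Polynomial.eq_zero_of_infinite_isRoot P (Set.Infinite.mono (s := {0}ᶜ) ?_ ?_)
  · intro x hx
    exact h x hx
  · exact (Set.finite_singleton 0).infinite_compl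

/-- The functional reading off the middle coefficient of a binary quadratic form. -/
def midCoeff : Module.Dual K (Forms K 2) :=
  evalAt 2 ![1, 1] - evalAt 2 ![1, 0] - evalAt 2 ![0, 1]

theorem forms_two_ext {s t : Module.Dual K (Forms K 2)}
    (h₀ : s (mono 2 0 rfl) = t (mono 2 0 rfl)) (h₁ : s (mono 1 1 rfl) = t (mono 1 1 rfl))
    (h₂ : s (mono 0 2 rfl) = t (mono 0 2 rfl)) : s = t := by
  refine forms_ext fun i j hij => ?_
  obtain ⟨rfl, rfl⟩ | ⟨rfl, rfl⟩ | ⟨rfl, rfl⟩ :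
      (i = 2 ∧ j = 0) ∨ (i = 1 ∧ j = 1) ∨ (i = 0 ∧ j = 2) := by omega
  · exact h₀
  · exact h₁
  · exact h₂

/-- An invariant covector field on the space of binary quadratic forms that vanishes on the
diagonal is zero. At a multiple of `midCoeff`, which is fixed by the torus, torus invariance makes
the field vanish on the evaluations at the two standard basis vectors, and it vanishes on
`midCoeff` by the diagonal condition. The translates of these multiples are dense. -/
theorem quadratic_field_eq_zero [CharZero K]
    (B : Module.Dual K (Forms K 2) → Module.Dual K (Forms K 2) → K)
    (hadd : ∀ s s' t, B (s + s') t = B s t + B s' t) (hsmul : ∀ c s t, B (c • s) t = c * B s t)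
    (hdiag : ∀ t, B t t = 0)
    (hinv : ∀ g s t, B (s ∘ₗ binaryForms K 2 g) (t ∘ₗ binaryForms K 2 g) = B s t)
    (hline : ∀ s t₀ t₁, ∃ P : Polynomial K, ∀ x : K, B s (t₀ + x • t₁) = P.eval x)
    (s t : Module.Dual K (Forms K 2)) : B s t = 0 := by
  have hmid : ∀ m : K, m ≠ 0 → ∀ s, B s (m • midCoeff) = 0 := by
    intro m hm s
    obtain ⟨g, hg⟩ := exists_SL_mulVec (2 : K) 0 0 2⁻¹ (by norm_num)
    have hgm : (m • midCoeff) ∘ₗ binaryForms K 2 g = m • midCoeff := by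
      rw [LinearMap.smul_comp]
      congr 1
      simp only [midCoeff, LinearMap.sub_comp, evalAt_comp, hg]
      refine forms_two_ext ?_ ?_ ?_ <;> simp
    have h₁ : B (evalAt 2 ![1, 0]) (m • midCoeff) = 0 := by
      have h := hinv g (evalAt 2 ![1, 0]) (m • midCoeff)
      rw [hgm, evalAt_comp, hg, show evalAt 2 ![2 * (![1, 0] : Fin 2 → K) 0 + 0 * ![1, 0] 1,
        0 * ![1, 0] 0 + 2⁻¹ * ![1, 0] 1] = (4 : K) • evalAt 2 ![1, 0] from by
          refine forms_two_ext ?_ ?_ ?_ <;> norm_num, hsmul] at h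
      linear_combination (1 / 3 : K) * h
    have h₂ : B (evalAt 2 ![0, 1]) (m • midCoeff) = 0 := by
      have h := hinv g (evalAt 2 ![0, 1]) (m • midCoeff)
      rw [hgm, evalAt_comp, hg, show evalAt 2 ![2 * (![0, 1] : Fin 2 → K) 0 + 0 * ![0, 1] 1,
        0 * ![0, 1] 0 + 2⁻¹ * ![0, 1] 1] = (1 / 4 : K) • evalAt 2 ![0, 1] from by
          refine forms_two_ext ?_ ?_ ?_ <;> norm_num, hsmul] at h
      linear_combination (-4 / 3 : K) * h
    have h₃ : B midCoeff (m • midCoeff) = 0 := by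
      have h := hdiag (m • midCoeff)
      rw [hsmul] at h
      exact (mul_eq_zero.1 h).resolve_left hm
    have hs : s = s (mono 2 0 rfl) • evalAt 2 ![1, 0] + s (mono 1 1 rfl) • midCoeff +
        s (mono 0 2 rfl) • evalAt 2 ![0, 1] := by
      refine forms_two_ext ?_ ?_ ?_ <;> simp [midCoeff]
    rw [hs, hadd, hadd, hsmul, hsmul, hsmul, h₁, h₂, h₃]
    simp
  have hsplit : ∀ (g : SL(2, K)) (m : K), m ≠ 0 → ∀ s,
      B s ((m • midCoeff) ∘ₗ binaryForms K 2 g) = 0 := by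
    intro g m hm s
    have hs : s = (s ∘ₗ binaryForms K 2 g⁻¹) ∘ₗ binaryForms K 2 g := by
      rw [LinearMap.comp_assoc, ← Module.End.mul_eq_comp, ← map_mul, inv_mul_cancel, map_one]
      rfl
    rw [hs, hinv, hmid m hm]
  have hgen : ∀ s t : Module.Dual K (Forms K 2), t (mono 2 0 rfl) ≠ 0 → B s t = 0 := by
    intro s t hA
    set a := t (mono 2 0 rfl) with ha
    set b := t (mono 1 1 rfl) with hb
    set c := t (mono 0 2 rfl) with hc
    obtain ⟨P, hP⟩ := hline s t (evalAt 2 ![0, 1])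
    have hroot : ∀ m : K, m ≠ 0 → P.eval ((b ^ 2 - m ^ 2) / a - c) = 0 := by
      intro m hm
      obtain ⟨g, hg⟩ := exists_SL_mulVec (a / (2 * m)) 1 ((b / m - 1) / 2) ((m + b) / a)
        (by field_simp; ring)
      rw [← hP]
      refine Eq.trans (congrArg (B s) ?_) (hsplit g m hm s)
      rw [LinearMap.smul_comp]
      simp only [midCoeff, LinearMap.sub_comp, evalAt_comp, hg]
      refine forms_two_ext ?_ ?_ ?_
      · simp [← ha]
        field_simp
        ring
      · simp [← hb]
        field_simp
        ring
      · simp [← hc]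
        field_simp
        ring
    have hP0 : P = 0 := by
      refine Polynomial.eq_zero_of_infinite_isRoot P (Set.infinite_of_injective_forall_mem
        (f := fun n : ℕ => (b ^ 2 - ((n : K) + 1) ^ 2) / a - c) ?_ ?_)
      · intro n n' hn
        have h1 : ((n : K) + 1) ^ 2 = ((n' : K) + 1) ^ 2 := by
          have := sub_left_inj.1 hn
          rw [div_left_inj' hA] at this
          exact sub_right_inj.1 this
        have h2 : (n + 1) ^ 2 = (n' + 1) ^ 2 := by exact_mod_cast h1
        have h3 := Nat.pow_left_injective (n := 2) (by norm_num) h2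
        omega
      · intro n
        exact hroot _ (Nat.cast_add_one_ne_zero n)
    have := hP 0
    rwa [zero_smul, add_zero, hP0, Polynomial.eval_zero] at this
  by_cases hA : t (mono 2 0 rfl) = 0
  · obtain ⟨P, hP⟩ := hline s t (evalAt 2 ![1, 0])
    have hP0 : P = 0 := by
      refine poly_eq_zero_of_ne fun x hx => ?_
      rw [← hP]
      refine hgen _ _ ?_
      simpa [hA] using hx
    have := hP 0
    rwa [zero_smul, add_zero, hP0, Polynomial.eval_zero] at this
  · exact hgen s t hA

theorem Frame.invariants_eq_bot [CharZero K] {ρ : Representation K SL(2, K) (Fin d →₀ K)}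
    (F : Frame ρ (fun _ : Fin 1 => 2)) : invariants ρ = ⊥ := by
  rw [eq_bot_iff]
  intro f hf
  rw [LieSubalgebra.mem_bot]
  obtain ⟨w, q, hq, hdiag⟩ := exists_phi_eq f
  have hπ : ∀ w, F.inc 0 (F.proj 0 w) = w := fun w => by simpa using F.sum_inc_proj w
  have hw : w = 0 := by
    rw [← hπ w, F.proj_eq_zero two_ne_zero (fun g => apply_eq_of_mem_invariants hf
      (fun σ τ => by rw [hq]; rfl) g), map_zero]
  have hdual : ∀ σ : Module.Dual K (Fin d →₀ K), σ = (σ ∘ₗ F.inc 0) ∘ₗ F.proj 0 := fun σ => by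
    exact LinearMap.ext fun w => congrArg σ (hπ w).symm
  refine eq_zero_of_phi fun σ τ => ?_
  have key : fieldEv σ τ q = 0 := by
    rw [hdual σ, hdual τ]
    refine quadratic_field_eq_zero
      (fun s t => fieldEv (s ∘ₗ F.proj 0) (t ∘ₗ F.proj 0) q) ?_ ?_ ?_ ?_ ?_ _ _
    · intro s s' t
      rw [LinearMap.add_comp, fieldEv_add_left]
    · intro c s t
      rw [LinearMap.smul_comp, fieldEv_smul_left]
    · intro t
      exact hdiag _
    · intro g s t
      have h := (mem_invariants_iff ρ f).1 hf g (s ∘ₗ F.proj 0) (t ∘ₗ F.proj 0)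
      rw [hq, hq, hw] at h
      have h2 := congrArg Prod.snd h
      simp only [LinearMap.comp_assoc] at h2 ⊢
      rw [← F.proj_map g 0]
      simpa [Aff.of] using h2
    · intro s t₀ t₁
      obtain ⟨P, hP⟩ := exists_fieldEv_line q (s ∘ₗ F.proj 0) 0 (t₀ ∘ₗ F.proj 0) (t₁ ∘ₗ F.proj 0)
      refine ⟨P, fun x => ?_⟩
      rw [← hP, smul_zero, add_zero, LinearMap.add_comp, LinearMap.smul_comp]
  rw [hq, key, hw]
  ext <;> simp

end Quadratic

/-! ### Invariants of a vector and trivial summands -/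

section Linear

variable {K : Type*} [Field K] {d : ℕ}

/-- The determinant `[u, v]` is the first coordinate of `u` once `v` is moved to `(0, 1)`. -/
theorem exists_SL_mulVec_eq {v : Fin 2 → K} (hv : v ≠ 0) : ∃ g : SL(2, K),
    (g⁻¹).1.mulVec v = ![0, 1] ∧ ∀ u, (g⁻¹).1.mulVec u 0 = u 0 * v 1 - u 1 * v 0 := by
  obtain ⟨r, s, h⟩ : ∃ r s, r * v 0 + s * v 1 = 1 := by
    by_cases h0 : v 0 = 0
    · have h1 : v 1 ≠ 0 := fun h1 => hv (by ext i; fin_cases i <;> simp [h0, h1])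
      exact ⟨0, (v 1)⁻¹, by field_simp; ring⟩
    · exact ⟨(v 0)⁻¹, 0, by field_simp; ring⟩
  obtain ⟨g, hg⟩ := exists_SL_mulVec (v 1) (-v 0) r s (by linear_combination h)
  refine ⟨g, ?_, fun u => ?_⟩
  · rw [hg, h, show v 1 * v 0 + -v 0 * v 1 = 0 by ring]
  · rw [hg]
    simp only [Matrix.cons_val_zero]
    ring

/-- A function on the plane that is invariant and polynomial on lines is constant. -/
theorem eq_zero_of_SL_invariant [CharZero K] {D : (Fin 2 → K) → K}
    (hinv : ∀ (g : SL(2, K)) v, D ((g⁻¹).1.mulVec v) = D v)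
    (hline : ∀ v, ∃ P : Polynomial K, ∀ x : K, D (x • v) = P.eval x) (v : Fin 2 → K) :
    D v = D 0 := by
  by_cases hv : v = 0
  · rw [hv]
  have hconst : ∀ v : Fin 2 → K, v ≠ 0 → D v = D ![0, 1] := by
    intro v hv
    obtain ⟨g, hg, -⟩ := exists_SL_mulVec_eq hv
    rw [← hinv g, hg]
  obtain ⟨P, hP⟩ := hline v
  have h : P - Polynomial.C (D ![0, 1]) = 0 := poly_eq_zero_of_ne fun x hx => by
    rw [Polynomial.eval_sub, Polynomial.eval_C, ← hP, hconst _ (smul_ne_zero hx hv), sub_self]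
  have h0 := hP 0
  rw [zero_smul, sub_eq_zero.1 h, Polynomial.eval_C] at h0
  rw [h0, hconst v hv]

/-- An invariant covector field on the plane that vanishes on the diagonal is a multiple of the
determinant. -/
theorem eq_det_mul_of_SL_invariant [CharZero K] {L : (Fin 2 → K) → (Fin 2 → K) → K}
    (hadd : ∀ u u' v, L (u + u') v = L u v + L u' v) (hsmul : ∀ c u v, L (c • u) v = c * L u v)
    (hdiag : ∀ v, L v v = 0)
    (hinv : ∀ (g : SL(2, K)) u v, L ((g⁻¹).1.mulVec u) ((g⁻¹).1.mulVec v) = L u v)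
    (hline : ∀ u v, ∃ P : Polynomial K, ∀ x : K, L u (x • v) = P.eval x) (u v : Fin 2 → K) :
    L u v = (u 0 * v 1 - u 1 * v 0) * L ![1, 0] ![0, 1] := by
  have hne : ∀ u v : Fin 2 → K, v ≠ 0 →
      L u v = (u 0 * v 1 - u 1 * v 0) * L ![1, 0] ![0, 1] := by
    intro u v hv
    obtain ⟨g, hg, hu⟩ := exists_SL_mulVec_eq hv
    rw [← hinv g, hg, ← hu]
    set w := (g⁻¹).1.mulVec u
    have hw : w = w 0 • ![1, 0] + w 1 • ![0, 1] := by
      ext i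
      fin_cases i <;> simp
    conv_lhs => rw [hw]
    rw [hadd, hsmul, hsmul, hdiag, mul_zero, add_zero]
  by_cases hv : v = 0
  · obtain ⟨P, hP⟩ := hline u ![0, 1]
    have h : P - Polynomial.C (u 0 * L ![1, 0] ![0, 1]) * Polynomial.X = 0 :=
      poly_eq_zero_of_ne fun x hx => by
        rw [Polynomial.eval_sub, ← hP, hne _ _ (smul_ne_zero hx fun h => by
          simpa using congrFun h 1)]
        simp
        ring
    have h0 := hP 0
    rw [zero_smul, sub_eq_zero.1 h] at h0
    rw [hv, h0]
    simp
  · exact hne u v hv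

/-- Linear forms are evaluated linearly in the point. -/
theorem evalAt_one_add {k : ℕ} (hk : k = 1) (u v : Fin 2 → K) :
    evalAt k (u + v) = evalAt k u + evalAt k v := by
  subst hk
  refine forms_ext fun i j hij => ?_
  obtain ⟨rfl, rfl⟩ | ⟨rfl, rfl⟩ : (i = 1 ∧ j = 0) ∨ (i = 0 ∧ j = 1) := by omega
  all_goals simp

theorem evalAt_one_smul {k : ℕ} (hk : k = 1) (c : K) (v : Fin 2 → K) :
    evalAt k (c • v) = c • evalAt k v := by
  subst hk
  refine forms_ext fun i j hij => ?_
  obtain ⟨rfl, rfl⟩ | ⟨rfl, rfl⟩ : (i = 1 ∧ j = 0) ∨ (i = 0 ∧ j = 1) := by omega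
  all_goals simp

theorem eq_evalAt_one {k : ℕ} (hk : k = 1) (s : Module.Dual K (Forms K k)) :
    s = evalAt k ![s (mono 1 0 hk.symm), s (mono 0 1 hk.symm)] := by
  subst hk
  refine forms_ext fun i j hij => ?_
  obtain ⟨rfl, rfl⟩ | ⟨rfl, rfl⟩ : (i = 1 ∧ j = 0) ∨ (i = 0 ∧ j = 1) := by omega
  all_goals simp

theorem binaryForms_zero {k : ℕ} (hk : k = 0) (g : SL(2, K)) :
    binaryForms K k g = LinearMap.id := by
  subst hk
  refine forms_ext fun i j hij => Subtype.ext ?_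
  obtain ⟨rfl, rfl⟩ : i = 0 ∧ j = 0 := by omega
  change polyAction K g _ = _
  simp [mono]

namespace Frame

variable {ρ : Representation K SL(2, K) (Fin d →₀ K)} {r : ℕ} {k : Fin r → ℕ}

theorem map_fixedPart (F : Frame ρ k) (g : SL(2, K)) : ρ g ∘ₗ F.fixedPart = F.fixedPart := by
  refine LinearMap.ext fun w => ?_
  simp only [fixedPart, LinearMap.comp_apply, LinearMap.sum_apply, map_sum]
  refine Finset.sum_congr rfl fun i hi => ?_
  have h := LinearMap.congr_fun (F.map_inc g i) (F.proj i w)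
  rwa [binaryForms_zero (Finset.mem_filter.1 hi).2] at h

theorem fixedPart_map (F : Frame ρ k) (g : SL(2, K)) : F.fixedPart ∘ₗ ρ g = F.fixedPart := by
  refine LinearMap.ext fun w => ?_
  simp only [fixedPart, LinearMap.comp_apply, LinearMap.sum_apply]
  refine Finset.sum_congr rfl fun i hi => ?_
  have h := LinearMap.congr_fun (F.proj_map g i) w
  rw [binaryForms_zero (Finset.mem_filter.1 hi).2] at h
  exact congrArg (F.inc i) h

theorem lin_fixedPart_mem (F : Frame ρ k) (w : Fin d →₀ K) :
    lin (F.fixedPart w) ∈ invariants ρ := fun g => by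
  rw [freeMetabelianMap_lin]
  exact congrArg lin (LinearMap.congr_fun (F.map_fixedPart g) w)

/-- The functional on `KX_d` that evaluates the `i`-th component at the point `v`. -/
def evalDual (F : Frame ρ k) (i : Fin r) (v : Fin 2 → K) : Module.Dual K (Fin d →₀ K) :=
  evalAt (k i) v ∘ₗ F.proj i

theorem evalDual_comp (F : Frame ρ k) (i : Fin r) (v : Fin 2 → K) (g : SL(2, K)) :
    F.evalDual i v ∘ₗ ρ g = F.evalDual i ((g⁻¹).1.mulVec v) := by
  rw [evalDual, evalDual, ← evalAt_comp, LinearMap.comp_assoc, F.proj_map, LinearMap.comp_assoc]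

/-- The point of the plane through which a functional acts on a summand of linear forms. -/
def point (F : Frame ρ k) {i : Fin r} (hi : k i = 1) (σ : Module.Dual K (Fin d →₀ K)) :
    Fin 2 → K :=
  ![σ (F.inc i (mono 1 0 hi.symm)), σ (F.inc i (mono 0 1 hi.symm))]

theorem point_comp (F : Frame ρ k) {i : Fin r} (hi : k i = 1) (g : SL(2, K))
    (σ : Module.Dual K (Fin d →₀ K)) :
    F.point hi (σ ∘ₗ ρ g) = (g⁻¹).1.mulVec (F.point hi σ) := by
  have h : (σ ∘ₗ ρ g) ∘ₗ F.inc i = evalAt (k i) ((g⁻¹).1.mulVec (F.point hi σ)) := by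
    rw [F.comp_inc, ← evalAt_comp, eq_evalAt_one hi (σ ∘ₗ F.inc i)]
    rfl
  ext j
  fin_cases j
  · have := LinearMap.congr_fun h (mono 1 0 hi.symm)
    simpa [point] using this
  · have := LinearMap.congr_fun h (mono 0 1 hi.symm)
    simpa [point] using this

theorem eq_evalDual_add (F : Frame ρ k) {i : Fin r} (hi : k i = 1) (h : ∀ j, j ≠ i → k j = 0)
    (σ : Module.Dual K (Fin d →₀ K)) :
    σ = F.evalDual i (F.point hi σ) + σ ∘ₗ F.fixedPart := by
  have h1 : F.evalDual i (F.point hi σ) = (σ ∘ₗ F.inc i) ∘ₗ F.proj i := by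
    rw [evalDual, eq_evalAt_one hi (σ ∘ₗ F.inc i)]
    rfl
  refine LinearMap.ext fun w => ?_
  have hi0 : k i ≠ 0 := by omega
  have h2 : (Finset.univ.filter fun j => k j = 0) = Finset.univ.erase i := by
    ext j
    simp only [Finset.mem_filter, Finset.mem_univ, true_and, Finset.mem_erase, and_true]
    exact ⟨fun hj hij => hi0 (hij ▸ hj), h j⟩
  conv_lhs => rw [← F.sum_inc_proj w]
  rw [h1, LinearMap.add_apply, fixedPart, h2, ← Finset.add_sum_erase _ _ (Finset.mem_univ i),
    map_add]
  simp

/-- The covector field of an invariant is the sum of a part depending only on the trivial summands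
and a multiple of the determinant, with a coefficient depending only on the trivial summands. -/
theorem fieldEv_eq_of_invariant [CharZero K] (F : Frame ρ k) {i : Fin r} (hi : k i = 1)
    (h : ∀ j, j ≠ i → k j = 0) {q : Fin d → MvPolynomial (Fin d) K}
    (hdiag : ∀ τ, fieldEv τ τ q = 0)
    (hinv : ∀ g σ τ, fieldEv (σ ∘ₗ ρ g) (τ ∘ₗ ρ g) q = fieldEv σ τ q)
    (σ τ : Module.Dual K (Fin d →₀ K)) :
    fieldEv σ τ q = fieldEv (σ ∘ₗ F.fixedPart) (τ ∘ₗ F.fixedPart) q +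
      (F.point hi σ 0 * F.point hi τ 1 - F.point hi σ 1 * F.point hi τ 0) *
        fieldEv (F.evalDual i ![1, 0]) (F.evalDual i ![0, 1] + τ ∘ₗ F.fixedPart) q := by
  have hadd : ∀ u v, F.evalDual i (u + v) = F.evalDual i u + F.evalDual i v := fun u v => by
    rw [evalDual, evalAt_one_add hi, LinearMap.add_comp, evalDual, evalDual]
  have hsmul : ∀ (c : K) v, F.evalDual i (c • v) = c • F.evalDual i v := fun c v => by
    rw [evalDual, evalAt_one_smul hi, LinearMap.smul_comp, evalDual]
  have hE : ∀ (χ : Module.Dual K (Fin d →₀ K)) g, (χ ∘ₗ F.fixedPart) ∘ₗ ρ g = χ ∘ₗ F.fixedPart :=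
    fun χ g => by rw [LinearMap.comp_assoc, F.fixedPart_map]
  have hD : ∀ (χ : Module.Dual K (Fin d →₀ K)) v,
      fieldEv (χ ∘ₗ F.fixedPart) (F.evalDual i v + τ ∘ₗ F.fixedPart) q =
        fieldEv (χ ∘ₗ F.fixedPart) (τ ∘ₗ F.fixedPart) q := by
    intro χ v
    have := eq_zero_of_SL_invariant (D := fun v =>
      fieldEv (χ ∘ₗ F.fixedPart) (F.evalDual i v + τ ∘ₗ F.fixedPart) q) ?_ ?_ v
    · have h0 : F.evalDual i 0 = 0 := by simpa using hsmul 0 0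
      simpa only [h0, zero_add] using this
    · intro g v
      rw [← F.evalDual_comp, ← hE τ g, ← LinearMap.add_comp, ← hE χ g, hinv, hE, hE]
    · intro v
      obtain ⟨P, hP⟩ := exists_fieldEv_line q (χ ∘ₗ F.fixedPart) 0 (τ ∘ₗ F.fixedPart)
        (F.evalDual i v)
      refine ⟨P, fun x => ?_⟩
      rw [← hP, smul_zero, add_zero, hsmul, add_comm]
  have hL := eq_det_mul_of_SL_invariant (L := fun u v =>
      fieldEv (F.evalDual i u) (F.evalDual i v + τ ∘ₗ F.fixedPart) q) ?_ ?_ ?_ ?_ ?_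
      (F.point hi σ) (F.point hi τ)
  · conv_lhs => rw [F.eq_evalDual_add hi h σ, F.eq_evalDual_add hi h τ]
    rw [fieldEv_add_left, hD, add_comm]
    exact congrArg _ hL
  · intro u u' v
    rw [hadd, fieldEv_add_left]
  · intro c u v
    rw [hsmul, fieldEv_smul_left]
  · intro v
    have h1 := hdiag (F.evalDual i v + τ ∘ₗ F.fixedPart)
    rwa [fieldEv_add_left, hD, hdiag, add_zero] at h1
  · intro g u v
    rw [← F.evalDual_comp, ← F.evalDual_comp, ← hE τ g, ← LinearMap.add_comp, hinv, hE]
  · intro u v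
    obtain ⟨P, hP⟩ := exists_fieldEv_line q (F.evalDual i u) 0 (τ ∘ₗ F.fixedPart)
      (F.evalDual i v)
    refine ⟨P, fun x => ?_⟩
    rw [← hP, smul_zero, add_zero, hsmul, add_comm]

/-- The invariants of `V_1 ⊕ V_0 ⊕ ⋯ ⊕ V_0` are generated by the trivial summands and the
commutator of a basis of `V_1`. -/
theorem isFinitelyGenerated_of_one [CharZero K] (F : Frame ρ k) {i : Fin r} (hi : k i = 1)
    (h : ∀ j, j ≠ i → k j = 0) : IsFinitelyGenerated (invariants ρ) := by
  classical
  set z : FreeMetabelian K d :=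
    ⁅lin (F.inc i (mono 1 0 hi.symm)), lin (F.inc i (mono 0 1 hi.symm))⁆ with hz
  have hphi : ∀ σ τ, phi σ τ z =
      Aff.of 0 (-(F.point hi σ 0 * F.point hi τ 1 - F.point hi σ 1 * F.point hi τ 0)) := by
    intro σ τ
    rw [hz, LieHom.map_lie, phi_lin, phi_lin]
    ext <;> simp [point]
    ring
  refine ⟨insert z (Finset.univ.image fun j => lin (F.fixedPart (Finsupp.single j 1))),
    le_antisymm (LieSubalgebra.lieSpan_le.2 ?_) ?_⟩
  · intro f hf
    rw [Finset.coe_insert, Set.mem_insert_iff, Finset.coe_image] at hf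
    obtain rfl | ⟨j, -, rfl⟩ := hf
    · refine (mem_invariants_iff ρ z).2 fun g σ τ => ?_
      rw [hphi, hphi, F.point_comp, F.point_comp]
      have hdet := (g⁻¹).2
      rw [Matrix.det_fin_two] at hdet
      simp only [Matrix.mulVec, dotProduct, Fin.sum_univ_two]
      congr 1
      linear_combination (F.point hi σ 1 * F.point hi τ 0 - F.point hi σ 0 * F.point hi τ 1) * hdet
    · exact F.lin_fixedPart_mem _
  · set A := LieSubalgebra.lieSpan K (FreeMetabelian K d)
      (insert z (Finset.univ.image fun j => lin (F.fixedPart (Finsupp.single j 1))) :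
        Finset (FreeMetabelian K d)) with hA
    have hzA : z ∈ A := LieSubalgebra.subset_lieSpan (by simp)
    have hgen : ∀ j, lin (F.fixedPart (Finsupp.single j 1)) ∈ A := fun j =>
      LieSubalgebra.subset_lieSpan (by simp)
    have hfix : ∀ w, lin (F.fixedPart w) ∈ A := by
      intro w
      rw [← freeMetabelianMap_lin]
      exact mem_of_gen_mem (A.comap (freeMetabelianMap F.fixedPart))
        (fun j => by
          change freeMetabelianMap F.fixedPart (lin _) ∈ A
          rw [freeMetabelianMap_lin]
          exact hgen j) (lin w)
    intro f hf
    obtain ⟨w, q, hq, hdiag⟩ := exists_phi_eq f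
    have hw : ∀ g, ρ g w = w := fun g =>
      apply_eq_of_mem_invariants hf (fun σ τ => by rw [hq]; rfl) g
    have hinv : ∀ g σ τ, fieldEv (σ ∘ₗ ρ g) (τ ∘ₗ ρ g) q = fieldEv σ τ q := by
      intro g σ τ
      have h1 := congrArg Prod.snd ((mem_invariants_iff ρ f).1 hf g σ τ)
      rw [hq, hq] at h1
      simpa [Aff.of, hw] using h1
    have h0 : freeMetabelianMap F.fixedPart f ∈ A :=
      mem_of_gen_mem (A.comap (freeMetabelianMap F.fixedPart)) (fun j => by
        change freeMetabelianMap F.fixedPart (lin _) ∈ A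
        rw [freeMetabelianMap_lin]
        exact hgen j) f
    choose y hyA hy using fun j => exists_mem_mul hfix (F.evalDual i ![0, 1]) (q j) hzA hphi
    have hsum : ∑ j, F.evalDual i ![1, 0] (Finsupp.single j 1) • y j ∈ A :=
      A.toSubmodule.sum_mem fun j _ => A.smul_mem _ (hyA j)
    have hf' : f = freeMetabelianMap F.fixedPart f -
        ∑ j, F.evalDual i ![1, 0] (Finsupp.single j 1) • y j := by
      refine eq_of_phi fun σ τ => ?_
      rw [map_sub, phi_map, hq, hq, map_sum, F.fieldEv_eq_of_invariant hi h hdiag hinv]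
      have h1 : F.fixedPart w = w := F.fixedPart_eq_self hw
      ext
      · simp [h1, Aff.sum_fst, hy]
      · simp [h1, Aff.sum_snd, hy, fieldEv, Finset.mul_sum]
        rw [← add_assoc, sub_eq_add_neg (σ w + _), ← Finset.sum_neg_distrib]
        congr 1
        exact Finset.sum_congr rfl fun j _ => by ring
    rw [hf']
    exact A.sub_mem h0 hsum

end Frame

end Linear

/-! ### Isomorphic sums of spaces of binary forms -/

section Reindex

variable {K : Type*} [Field K]

/-- Permuting the summands gives an isomorphic module. -/
theorem nonempty_equiv_reindex {r s : ℕ} {k : Fin r → ℕ} {k' : Fin s → ℕ} (e : Fin r ≃ Fin s)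
    (h : ∀ i, k (e.symm i) = k' i) :
    Nonempty ((sumOfBinaryForms K k).Equiv (sumOfBinaryForms K k')) := by
  obtain rfl : (fun i => k (e.symm i)) = k' := funext h
  refine ⟨Representation.Equiv.mk
    (DirectSum.lequivCongrLeft K (M := fun i => Forms K (k i)) e) fun g => ?_⟩
  refine LinearMap.ext fun v => ?_
  refine DFinsupp.ext fun i => ?_
  rfl

/-- A sum with one summand is isomorphic to that summand. -/
theorem nonempty_equiv_single (n : ℕ) :
    Nonempty ((binaryForms K n).Equiv (sumOfBinaryForms K (fun _ : Fin 1 => n))) := by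
  have key : ∀ h : Forms K n, DirectSum.component K (Fin 1) (fun _ => Forms K n) 0
      (DirectSum.lof K (Fin 1) (fun _ => Forms K n) 0 h) = h := fun h => by
    rw [DirectSum.component.lof_self]
  refine ⟨Representation.Equiv.mk (LinearEquiv.ofLinearMap
    (DirectSum.lof K (Fin 1) (fun _ => Forms K n) 0)
    (DirectSum.component K (Fin 1) (fun _ => Forms K n) 0) ?_ ?_) fun g => ?_⟩
  · refine LinearMap.ext fun v => DFinsupp.ext fun i => ?_
    obtain rfl := Subsingleton.elim i 0
    exact key _
  · exact LinearMap.ext key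
  · exact LinearMap.ext fun h => (DirectSum.lmap_lof
      (fun _ : Fin 1 => binaryForms K n g) 0 h).symm

end Reindex

/-! ### The classification -/

theorem isFinitelyGenerated_bot {K L : Type*} [Field K] [LieRing L] [LieAlgebra K L] :
    IsFinitelyGenerated (⊥ : LieSubalgebra K L) :=
  ⟨∅, by simp⟩

section Classification

variable {K : Type*} [Field K] [CharZero K] {d : ℕ}
  {ρ : Representation K SL(2, K) (Fin d →₀ K)}

/-- If the invariants are finitely generated, the parities and sizes of the degrees leave only
one nonzero degree, equal to `1` with trivial complement, or to `2` with no complement. -/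
theorem exists_equiv_of_isFinitelyGenerated {r : ℕ} {k : Fin r → ℕ} (hk : ∃ i, k i ≠ 0)
    (e : ρ.Equiv (sumOfBinaryForms K k)) (hfg : IsFinitelyGenerated (invariants ρ)) :
    (∃ m : ℕ, Nonempty (ρ.Equiv (sumOfBinaryForms K
      (Fin.cons 1 (fun _ => 0) : Fin (m + 1) → ℕ)))) ∨ Nonempty (ρ.Equiv (binaryForms K 2)) := by
  let F := Frame.ofEquiv e
  by_cases hodd : ∃ i, Odd (k i)
  · obtain ⟨i, hi⟩ := hodd
    have hle : ∀ j, k j < 2 := fun j => by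
      by_contra hj
      exact F.not_fg_of_odd_of_two_le hi (not_lt.1 hj) hfg
    have hi1 : k i = 1 := by
      have := hle i
      have := hi.pos
      omega
    have h0 : ∀ j, j ≠ i → k j = 0 := fun j hj => by
      by_contra hj0
      have := hle j
      exact F.not_fg_of_one_of_one hj.symm hi1 (by omega) hfg
    obtain ⟨m, rfl⟩ : ∃ m, r = m + 1 := ⟨r - 1, by have := i.pos; omega⟩
    obtain ⟨e'⟩ := nonempty_equiv_reindex (K := K) (k := k)
      (k' := (Fin.cons 1 (fun _ => 0) : Fin (m + 1) → ℕ)) (Equiv.swap i 0) fun j => by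
        refine Fin.cases ?_ (fun j => ?_) j
        · rw [Equiv.symm_swap, Equiv.swap_apply_right, hi1, Fin.cons_zero]
        · rw [Equiv.symm_swap, Fin.cons_succ]
          refine h0 _ fun h => ?_
          rw [Equiv.swap_apply_eq_iff, Equiv.swap_apply_left] at h
          exact Fin.succ_ne_zero j h
    exact Or.inl ⟨m, ⟨e.trans e'⟩⟩
  · have heven : ∀ j, Even (k j) := fun j => Nat.not_odd_iff_even.1 fun h => hodd ⟨j, h⟩
    obtain ⟨i, hi⟩ := hk
    have hone : ∀ j, j = i := fun j => by
      by_contra hj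
      exact F.not_fg_of_even_of_even (Ne.symm hj) (heven i) hi (heven j) hfg
    have hi2 : k i = 2 := by
      have h4 : k i ≠ 4 := fun h => F.not_fg_of_four h hfg
      have h6 : ¬ 6 ≤ k i := fun h => F.not_fg_of_six_le (heven i) h hfg
      obtain ⟨n, hn⟩ := heven i
      omega
    have : Unique (Fin r) := ⟨⟨i⟩, hone⟩
    obtain ⟨e₁⟩ := nonempty_equiv_reindex (K := K) (k := k) (k' := fun _ : Fin 1 => 2)
      (Equiv.ofUnique (Fin r) (Fin 1)) fun j => by
        rw [hone ((Equiv.ofUnique (Fin r) (Fin 1)).symm j), hi2]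
    obtain ⟨e₂⟩ := nonempty_equiv_single (K := K) 2
    exact Or.inr ⟨(e.trans e₁).trans e₂.symm⟩

theorem isFinitelyGenerated_of_equiv
    (h : (∃ m : ℕ, Nonempty (ρ.Equiv (sumOfBinaryForms K
      (Fin.cons 1 (fun _ => 0) : Fin (m + 1) → ℕ)))) ∨ Nonempty (ρ.Equiv (binaryForms K 2))) :
    IsFinitelyGenerated (invariants ρ) := by
  obtain ⟨m, ⟨e⟩⟩ | ⟨⟨e⟩⟩ := h
  · refine (Frame.ofEquiv e).isFinitelyGenerated_of_one (i := 0) rfl fun j hj => ?_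
    obtain ⟨j, rfl⟩ := Fin.exists_succ_eq.2 hj
    rfl
  · obtain ⟨e'⟩ := nonempty_equiv_single (K := K) 2
    rw [(Frame.ofEquiv (e.trans e')).invariants_eq_bot]
    exact isFinitelyGenerated_bot

end Classification

end MetabelianInvariants

end

theorem theorem3p7 {K : Type*} [Field K] [CharZero K] {d : ℕ}
    (ρ : Representation K (Matrix.SpecialLinearGroup (Fin 2) K) (Fin d →₀ K))
    {r : ℕ} (k : Fin r → ℕ) (hk : ∃ i, k i ≠ 0)
    (hρ : Nonempty (ρ.Equiv (MetabelianInvariants.sumOfBinaryForms K k))) :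
    MetabelianInvariants.IsFinitelyGenerated (MetabelianInvariants.invariants ρ) ↔
      (∃ m : ℕ, Nonempty (ρ.Equiv (MetabelianInvariants.sumOfBinaryForms K
        (Fin.cons 1 (fun _ => 0) : Fin (m + 1) → ℕ)))) ∨
      Nonempty (ρ.Equiv (MetabelianInvariants.binaryForms K 2)) := by
  obtain ⟨e⟩ := hρ
  exact ⟨MetabelianInvariants.exists_equiv_of_isFinitelyGenerated hk e,
    MetabelianInvariants.isFinitelyGenerated_of_equiv⟩
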